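/- Let $n,d,D$ be non-negative integers. There is an integer $M$, depending only on $n$, $d$ and $D$, with the following property. Let $K\subset\overline{\mathbb Q}$ be a number field with $[K:\mathbb Q]=d$, and let $V\subset\mathbb G_m^n$ be a (possibly reducible) closed algebraic subvariety defined over $K$, that is, the set of common zeros in $(\overline{\mathbb Q}^*)^n$ of a set of polynomials in $K[X_1,\dots,X_n]$, of geometric degree $D$. If $\zeta\in V(\overline{\mathbb Q})$ is a torsion point of $\mathbb G_m^n$ of order at least $M$, then there is a torsion coset $T$ of positive dimension with $\zeta\in T\subset V$. Here a torsion coset is a translate $gH$ of a subtorus $H$ (an irreducible closed algebraic subgroup) of $\mathbb G_m^n$ by a torsion point $g$. The geometric degree of $V$ is the sum of the degrees of all irreducible components over $\overline{\mathbb Q}$, of whatever dimension, of the Zariski closure of $V$ in affine space $\mathbb A^n$; the degree of an irreducible closed $X\subset\mathbb A^n$ is the largest number of points in a finite intersection $X\cap L$, where $L$ runs over the affine linear subspaces of codimension $\dim X$. -/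

import Mathlib

/-- The field of algebraic numbers. -/
abbrev Qbar : Type := AlgebraicClosure ℚ

/-- The group of algebraic points of the `n`-dimensional multiplicative torus. -/
abbrev Gm (n : ℕ) : Type := Fin n → Qbarˣ

namespace Gm

/-- The inclusion of the torus in affine space. -/
def toAffine {n : ℕ} (x : Gm n) : Fin n → Qbar := fun i => (x i : Qbar)

/-- `V` is a (possibly reducible) closed subvariety of the torus defined over `K`: the set of
common zeros in the torus of some polynomials with coefficients in `K`. -/
def IsDefinedOver {n : ℕ} (K : Type) [Field K] [Algebra K Qbar] (V : Set (Gm n)) : Prop :=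
  ∃ S : Set (MvPolynomial (Fin n) K),
    V = {x | ∀ P ∈ S, MvPolynomial.aeval (toAffine x) P = 0}

/-- The ideal of all polynomials over the algebraic numbers that vanish on `V`. -/
noncomputable def ideal {n : ℕ} (V : Set (Gm n)) : Ideal (MvPolynomial (Fin n) Qbar) :=
  MvPolynomial.vanishingIdeal Qbar (toAffine '' V)

/-- The dimension of the Zariski closure of `V`: the Krull dimension of its coordinate ring. -/
noncomputable def dim {n : ℕ} (V : Set (Gm n)) : WithBot ℕ∞ :=
  ringKrullDim (MvPolynomial (Fin n) Qbar ⧸ ideal V)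

/-- The degree of the irreducible affine variety `X` with prime ideal `p`: the largest number of
points in a finite intersection of `X` with an affine linear subspace of codimension `dim X`. -/
noncomputable def primeDegree {n : ℕ} (p : Ideal (MvPolynomial (Fin n) Qbar)) : ℕ∞ :=
  ⨆ (L : AffineSubspace Qbar (Fin n → Qbar))
    (_ : (Module.finrank Qbar L.direction : WithBot ℕ∞)
      + ringKrullDim (MvPolynomial (Fin n) Qbar ⧸ p) = (n : WithBot ℕ∞))
    (_ : (MvPolynomial.zeroLocus Qbar p ∩ (L : Set (Fin n → Qbar))).Finite),
    (MvPolynomial.zeroLocus Qbar p ∩ (L : Set (Fin n → Qbar))).encard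

/-- The geometric degree of `V`: the sum of the degrees of all irreducible components (of any
dimension) of its Zariski closure, which correspond to the minimal primes over its ideal. -/
noncomputable def geometricDegree {n : ℕ} (V : Set (Gm n)) : ℕ∞ :=
  ∑ p ∈ (Ideal.finite_minimalPrimes_of_isNoetherianRing
    (MvPolynomial (Fin n) Qbar) (ideal V)).toFinset, primeDegree p

/-- A subtorus: an irreducible Zariski closed subgroup. -/
def IsSubtorus {n : ℕ} (H : Subgroup (Gm n)) : Prop :=
  IsDefinedOver Qbar (H : Set (Gm n)) ∧ (ideal (H : Set (Gm n))).IsPrime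

/-- A torsion coset: a translate of a subtorus by a point of finite order. -/
def IsTorsionCoset {n : ℕ} (T : Set (Gm n)) : Prop :=
  ∃ (H : Subgroup (Gm n)) (g : Gm n), IsSubtorus H ∧ IsOfFinOrder g ∧ T = {x | ∃ h ∈ H, x = g * h}

end Gm

/-! The point ζ is shown to lie on a translate of a one-parameter subgroup with small exponents, on
which it has too many Galois conjugates for the translate to leave `V`.

Let ζ have order N. Simultaneous approximation of its exponents modulo N, with denominator q ≤ X^n <
N, gives ζ = g · (t^{b_1}, …, t^{b_n}), where t has order Nq, the coordinates of g are powers of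
t^N, and 0 ≠ b with |b_i| < N/X (`Gm.exists_eq_mul_oneParameter`). At least φ(N)/d conjugates of t
over K arise from automorphisms fixing t^N, hence g (`IsPrimitiveRoot.exists_conjugates`); each
gives a conjugate of ζ lying both on `V` and on the curve s ↦ g · s^b.

A polynomial of degree at most D restricts to this curve as a Laurent polynomial in s with at most
2DN/X nonzero roots, unless it vanishes identically. As φ(N) ≥ N/(log₂ N + 1), taking X slightly
above 2Dd(log₂ N + 1) makes the conjugates outnumber the roots, and X^n < N holds once N is large.
So every polynomial of degree at most D vanishing on `V` vanishes on the curve.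

It remains that `V` is cut out by polynomials of degree at most its geometric degree
(`Gm.exists_mem_ideal_totalDegree_le_geometricDegree`). A component of dimension r is projected
linearly to a hypersurface in (r+1)-space avoiding the image of a given outside point. The degree of
the hypersurface is its number of points on a suitable line, and these lift to a linear section of
the component. -/

/-! ### Krull dimension in integral extensions -/

section KrullDimension

variable {R A : Type*} [CommRing R] [CommRing A] [Algebra R A]

theorem ringKrullDim_le_of_isIntegral [Algebra.IsIntegral R A] :
    ringKrullDim A ≤ ringKrullDim R := by
  refine Order.krullDim_le_of_strictMono (PrimeSpectrum.comap (algebraMap R A)) ?_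
  intro P Q h
  obtain ⟨hle, x, hx, hx'⟩ := SetLike.lt_iff_le_and_exists.mp (show P.asIdeal < Q.asIdeal from h)
  exact Ideal.comap_lt_comap_of_integral_mem_sdiff (R := R) hle ⟨hx, hx'⟩
    (Algebra.IsIntegral.isIntegral x)

/-- Going up: a chain of primes lifts step by step, starting over the zero ideal by injectivity. -/
theorem ringKrullDim_ge_of_isIntegral_of_injective [Algebra.IsIntegral R A]
    (hinj : Function.Injective (algebraMap R A)) :
    ringKrullDim R ≤ ringKrullDim A := by
  have up : ∀ (I : Ideal A) (P : PrimeSpectrum R), I.comap (algebraMap R A) ≤ P.asIdeal →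
      ∃ Q : PrimeSpectrum A, I ≤ Q.asIdeal ∧ PrimeSpectrum.comap (algebraMap R A) Q = P := by
    intro I P h
    obtain ⟨Q, hQ, hp, hc⟩ := Ideal.exists_ideal_over_prime_of_isIntegral P.asIdeal I h
    exact ⟨⟨Q, hp⟩, hQ, PrimeSpectrum.ext hc⟩
  refine iSup_le fun l => ?_
  -- The chain is prolonged by its last term, so that the lift can be built by recursion on ℕ.
  let a : ℕ → PrimeSpectrum R := fun i => l ⟨min i l.length, by omega⟩
  have ha : Monotone a := fun i j h => l.monotone (by
    rw [Fin.le_def]; exact min_le_min_right _ h)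
  obtain ⟨Q0, -, hQ0⟩ := up ⊥ (a 0) (by
    rw [← RingHom.ker_eq_comap_bot, (RingHom.injective_iff_ker_eq_bot _).mp hinj]; exact bot_le)
  have step : ∀ (i : ℕ) (Q : {Q : PrimeSpectrum A // PrimeSpectrum.comap (algebraMap R A) Q = a i}),
      ∃ Q' : {Q : PrimeSpectrum A // PrimeSpectrum.comap (algebraMap R A) Q = a (i + 1)},
        Q.1 ≤ Q'.1 := by
    rintro i ⟨Q, hQ⟩
    obtain ⟨Q', h1, h2⟩ := up Q.asIdeal (a (i + 1)) (by
      have : a i ≤ a (i + 1) := ha (Nat.le_succ i)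
      rw [← hQ] at this
      exact this)
    exact ⟨⟨Q', h2⟩, h1⟩
  choose next hnext using step
  let q : (i : ℕ) → {Q : PrimeSpectrum A // PrimeSpectrum.comap (algebraMap R A) Q = a i} :=
    fun i => Nat.rec ⟨Q0, hQ0⟩ next i
  have hq : Monotone (fun i => (q i).1) := monotone_nat_of_le_succ fun i => hnext i (q i)
  let l' : LTSeries (PrimeSpectrum A) := LTSeries.mk l.length (fun i => (q i).1) (by
    intro i j hij
    refine lt_of_le_of_ne (hq hij.le) fun h => ?_
    have h1 : a i = a j := by exact (q i).2.symm.trans ((congrArg _ h).trans (q j).2)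
    have h2 := l.strictMono hij
    have e : ∀ k : Fin (l.length + 1), a k = l k := fun k => by
      have : min (k : ℕ) l.length = k := by omega
      simp only [a, this]
    rw [← e, ← e, h1] at h2
    exact lt_irrefl _ h2)
  exact le_iSup (fun l : LTSeries (PrimeSpectrum A) => (l.length : WithBot ℕ∞)) l'

theorem ringKrullDim_eq_of_isIntegral_of_injective [Algebra.IsIntegral R A]
    (hinj : Function.Injective (algebraMap R A)) :
    ringKrullDim A = ringKrullDim R :=
  le_antisymm ringKrullDim_le_of_isIntegral (ringKrullDim_ge_of_isIntegral_of_injective hinj)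

end KrullDimension

/-! ### Polynomials restricted to lines -/

section LineRestriction

open Polynomial in
/-- The restriction of `F` to the parametrized line `t ↦ u + t v`. -/
noncomputable def lineRestrict {σ k R : Type*} [CommRing k] [CommRing R] [Algebra k R]
    (u : σ → R) (v : σ → k) : MvPolynomial σ k →ₐ[k] R[X] :=
  MvPolynomial.aeval fun i => C (u i) + C (algebraMap k R (v i)) * X

variable {σ k R : Type*} [CommRing k] [CommRing R] [Algebra k R]

theorem eval_lineRestrict {S : Type*} [CommRing S] [Algebra k S] [Algebra R S]
    [IsScalarTower k R S] (u : σ → R) (v : σ → k) (s : S) (F : MvPolynomial σ k) :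
    Polynomial.aeval s (lineRestrict u v F) =
      MvPolynomial.aeval (fun i => algebraMap R S (u i) + algebraMap k S (v i) * s) F := by
  have : ((Polynomial.aeval (R := R) s).restrictScalars k).comp (lineRestrict u v) =
      MvPolynomial.aeval (fun i => algebraMap R S (u i) + algebraMap k S (v i) * s) := by
    ext i
    simp [lineRestrict, ← IsScalarTower.algebraMap_apply]
  exact DFunLike.congr_fun this F

theorem Polynomial.coeff_prod_sum_of_natDegree_le {ι R : Type*} [CommSemiring R] (s : Finset ι)
    (f : ι → Polynomial R) (e : ι → ℕ) (h : ∀ i ∈ s, (f i).natDegree ≤ e i) :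
    (∏ i ∈ s, f i).coeff (∑ i ∈ s, e i) = ∏ i ∈ s, (f i).coeff (e i) := by
  classical
  induction s using Finset.induction_on with
  | empty => simp
  | insert a s ha ih =>
    rw [Finset.prod_insert ha, Finset.sum_insert ha, Finset.prod_insert ha,
      Polynomial.coeff_mul_add_eq_of_natDegree_le (h a (Finset.mem_insert_self a s)),
      ih fun i hi => h i (Finset.mem_insert_of_mem hi)]
    exact (Polynomial.natDegree_prod_le _ _).trans
      (Finset.sum_le_sum fun i hi => h i (Finset.mem_insert_of_mem hi))

theorem natDegree_lineRestrict_monomial_le (u : σ → R) (v : σ → k) (m : σ →₀ ℕ) (c : k) :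
    (lineRestrict u v (MvPolynomial.monomial m c)).natDegree ≤ m.degree := by
  rw [lineRestrict, MvPolynomial.aeval_monomial]
  refine (Polynomial.natDegree_C_mul_le _ _).trans ?_
  refine (Polynomial.natDegree_prod_le _ _).trans (Finset.sum_le_sum fun i _ => ?_)
  refine (Polynomial.natDegree_pow_le_of_le (m := 1) _ ?_).trans (by simp)
  compute_degree

theorem coeff_lineRestrict_monomial (u : σ → R) (v : σ → k) (m : σ →₀ ℕ) (c : k) :
    (lineRestrict u v (MvPolynomial.monomial m c)).coeff m.degree =
      algebraMap k R (MvPolynomial.eval v (MvPolynomial.monomial m c)) := by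
  have h1 : ∀ i, (Polynomial.C (u i) +
      Polynomial.C (algebraMap k R (v i)) * Polynomial.X).natDegree ≤ 1 := by
    intro i; compute_degree
  rw [lineRestrict, MvPolynomial.aeval_monomial, Polynomial.algebraMap_apply,
    Polynomial.coeff_C_mul, Finsupp.prod, Finsupp.degree_apply,
    Polynomial.coeff_prod_sum_of_natDegree_le, MvPolynomial.eval_monomial, map_mul, Finsupp.prod,
    map_prod]
  · congr 1
    refine Finset.prod_congr rfl fun i _ => ?_
    have := Polynomial.coeff_pow_of_natDegree_le (m := m i) (h1 i)
    rw [mul_one] at this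
    rw [this]
    simp
  · intro i _
    exact (Polynomial.natDegree_pow_le_of_le _ (h1 i)).trans (by simp)

theorem natDegree_lineRestrict_le (u : σ → R) (v : σ → k) (F : MvPolynomial σ k) :
    (lineRestrict u v F).natDegree ≤ F.totalDegree := by
  conv_lhs => rw [F.as_sum, map_sum]
  refine Polynomial.natDegree_sum_le_of_forall_le _ _ fun m hm => ?_
  exact (natDegree_lineRestrict_monomial_le u v m _).trans (MvPolynomial.le_totalDegree hm)

/-- Only monomials of top degree reach this power of t, and they do so through `v` alone. The
coefficient is thus a scalar independent of `u`, so the restriction is monic up to a unit when that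
scalar is nonzero. -/
theorem coeff_lineRestrict (u : σ → R) (v : σ → k) (F : MvPolynomial σ k) :
    (lineRestrict u v F).coeff F.totalDegree =
      algebraMap k R (MvPolynomial.eval v (MvPolynomial.homogeneousComponent F.totalDegree F)) := by
  conv_lhs => rw [F.as_sum, map_sum, Polynomial.finsetSum_coeff, ← F.as_sum]
  rw [MvPolynomial.homogeneousComponent_apply, map_sum, map_sum, Finset.sum_filter]
  refine Finset.sum_congr rfl fun m hm => ?_
  split_ifs with h
  · rw [← h, coeff_lineRestrict_monomial]
  · refine Polynomial.coeff_eq_zero_of_natDegree_lt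
      ((natDegree_lineRestrict_monomial_le u v m _).trans_lt ?_)
    exact lt_of_le_of_ne (MvPolynomial.le_totalDegree hm) h

theorem MvPolynomial.IsHomogeneous.eval_const_mul {σ k : Type*} [CommSemiring k]
    {F : MvPolynomial σ k} {e : ℕ} (hF : F.IsHomogeneous e) (a : k) (v : σ → k) :
    MvPolynomial.eval (fun i => a * v i) F = a ^ e * MvPolynomial.eval v F := by
  rw [MvPolynomial.eval_eq, MvPolynomial.eval_eq, Finset.mul_sum]
  refine Finset.sum_congr rfl fun m hm => ?_
  have hd : m.degree = e := by
    rw [Finsupp.degree_eq_weight_one]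
    exact hF (MvPolynomial.mem_support_iff.mp hm)
  simp only [mul_pow, Finset.prod_mul_distrib, Finset.prod_pow_eq_pow_sum]
  rw [← hd, Finsupp.degree_apply]
  ring

theorem ne_zero_of_eval_homogeneousComponent_ne_zero {σ k : Type*} [CommSemiring k]
    {F : MvPolynomial σ k} {d : ℕ} (hd : d ≠ 0) {c : σ → k}
    (hc : MvPolynomial.eval c (MvPolynomial.homogeneousComponent d F) ≠ 0) : c ≠ 0 := by
  rintro rfl
  have := (MvPolynomial.homogeneousComponent_isHomogeneous d F).eval_const_mul 0 0
  rw [zero_pow hd, zero_mul] at this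
  exact hc (by simpa using this)

theorem exists_eval_homogeneousComponent_ne_zero {σ k : Type*} [Field k] [Infinite k]
    {F : MvPolynomial σ k} (hF : F ≠ 0) :
    ∃ v, MvPolynomial.eval v (MvPolynomial.homogeneousComponent F.totalDegree F) ≠ 0 := by
  by_contra! h
  have h0 : MvPolynomial.homogeneousComponent F.totalDegree F = 0 :=
    MvPolynomial.funext fun v => by rw [h v, map_zero]
  obtain ⟨m, hm, hd⟩ := Finset.exists_mem_eq_sup F.support
    (MvPolynomial.support_nonempty.mpr hF) fun m => m.degree
  have := congrArg (MvPolynomial.coeff m) h0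
  rw [MvPolynomial.coeff_homogeneousComponent, if_pos] at this
  · exact MvPolynomial.mem_support_iff.mp hm (by simpa using this)
  · exact hd.symm

end LineRestriction

/-! ### Noether normalization -/

section NoetherNormalization

/-- Noether normalization by linear forms over an infinite field. -/
theorem exists_algebraicIndependent_isIntegral_of_span {k A : Type*} [Field k] [Infinite k]
    [CommRing A] [Nontrivial A] [Algebra k A] (W : Submodule k A) (s : ℕ) (w : Fin s → A)
    (hw : ∀ i, w i ∈ W) (hint : Algebra.IsIntegral (Algebra.adjoin k (Set.range w)) A) :
    ∃ (r : ℕ) (w : Fin r → A), (∀ i, w i ∈ W) ∧ AlgebraicIndependent k w ∧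
      Algebra.IsIntegral (Algebra.adjoin k (Set.range w)) A := by
  induction s with
  | zero =>
    refine ⟨0, w, hw, ?_, hint⟩
    rw [algebraicIndependent_empty_type_iff]
    exact (algebraMap k A).injective
  | succ s ih =>
    by_cases hind : AlgebraicIndependent k w
    · exact ⟨_, w, hw, hind, hint⟩
    rw [algebraicIndependent_iff] at hind
    push Not at hind
    obtain ⟨F, hF, hF0⟩ := hind
    obtain ⟨c, hc⟩ := exists_eval_homogeneousComponent_ne_zero hF0
    have hdeg : F.totalDegree ≠ 0 := by
      intro h
      rw [MvPolynomial.totalDegree_eq_zero_iff_eq_C] at h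
      rw [h, MvPolynomial.aeval_C, map_eq_zero_iff _ (algebraMap k A).injective] at hF
      rw [hF, map_zero] at h
      exact hF0 h
    have hc0 : c ≠ 0 := ne_zero_of_eval_homogeneousComponent_ne_zero hdeg hc
    obtain ⟨i₀, hi₀⟩ := Function.ne_iff.mp hc0
    -- With `v i₀ = 1`, the point with coordinates `w i - v i * w i₀` has `i₀`-th coordinate zero,
    -- leaving `s` generators. The line through it in direction `v` reaches `w` at parameter `w i₀`,
    -- so the relation `F` becomes an integral equation for `w i₀`.
    let v : Fin (s + 1) → k := fun i => c i / c i₀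
    have hv : MvPolynomial.eval v (MvPolynomial.homogeneousComponent F.totalDegree F) ≠ 0 := by
      have := (MvPolynomial.homogeneousComponent_isHomogeneous F.totalDegree F).eval_const_mul
        (c i₀) v
      have e : (fun i => c i₀ * v i) = c := funext fun i => mul_div_cancel₀ _ hi₀
      rw [e] at this
      exact right_ne_zero_of_mul (this ▸ hc)
    let w' : Fin s → A := fun j => w (i₀.succAbove j) - algebraMap k A (v (i₀.succAbove j)) * w i₀
    refine ih w' (fun j => ?_) ?_
    · change _ - algebraMap k A _ * _ ∈ W
      rw [← Algebra.smul_def]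
      exact W.sub_mem (hw _) (W.smul_mem _ (hw _))
    let B := Algebra.adjoin k (Set.range w')
    have hu : ∀ i, w i - algebraMap k A (v i) * w i₀ ∈ B := by
      refine (Fin.forall_iff_succAbove i₀).mpr ⟨?_, fun j => ?_⟩
      · have : v i₀ = 1 := div_self hi₀
        simp [this]
      · exact Algebra.subset_adjoin ⟨j, rfl⟩
    let u : Fin (s + 1) → B := fun i => ⟨_, hu i⟩
    have h0 : IsIntegral B (w i₀) := by
      let f := lineRestrict u v F
      have hroot : Polynomial.aeval (w i₀) f = 0 := by
        rw [eval_lineRestrict, ← hF]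
        congr 2
        funext i
        change w i - algebraMap k A (v i) * w i₀ + _ = _
        ring
      set a := MvPolynomial.eval v (MvPolynomial.homogeneousComponent F.totalDegree F) with ha
      refine ⟨Polynomial.C (algebraMap k B a⁻¹) * f, ?_, ?_⟩
      · refine Polynomial.monic_of_natDegree_le_of_coeff_eq_one F.totalDegree
          ((Polynomial.natDegree_C_mul_le _ _).trans (natDegree_lineRestrict_le u v F)) ?_
        rw [Polynomial.coeff_C_mul, coeff_lineRestrict, ← map_mul, ← ha, inv_mul_cancel₀ hv,
          map_one]
      · rw [← Polynomial.aeval_def, map_mul, hroot, mul_zero]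
    have hall : ∀ i, IsIntegral B (w i) := by
      intro i
      have : w i = algebraMap B A (u i) + (algebraMap B A (algebraMap k B (v i))) * w i₀ := by
        change _ = w i - algebraMap k A (v i) * w i₀ + algebraMap k A (v i) * w i₀
        ring
      rw [this]
      exact isIntegral_algebraMap.add (isIntegral_algebraMap.mul h0)
    have hle : Algebra.adjoin k (Set.range w) ≤ (integralClosure B A).restrictScalars k :=
      Algebra.adjoin_le (by rintro _ ⟨i, rfl⟩; exact hall i)
    let B' : Subalgebra B A := integralClosure B A
    have hB' : Algebra.IsIntegral B' A := by
      refine ⟨fun a => ?_⟩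
      obtain ⟨f, hf, hfa⟩ := hint.isIntegral a
      let ι : Algebra.adjoin k (Set.range w) →+* B' :=
        (algebraMap (Algebra.adjoin k (Set.range w)) A).codRestrict B' fun x => hle x.2
      refine ⟨f.map ι, hf.map _, ?_⟩
      rw [Polynomial.eval₂_map]
      exact hfa
    exact Algebra.IsIntegral.trans B'

end NoetherNormalization

/-! ### Lines transverse to a hypersurface -/

section GenericLine

open Polynomial in
-- By Gauss's lemma `f` stays irreducible, hence separable, over the fraction field; `c` clears the
-- denominators of the Bézout identity.
theorem exists_bezout_derivative_of_monic_irreducible {R : Type*} [CommRing R] [IsDomain R]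
    [IsIntegrallyClosed R] [CharZero R] {f : R[X]} (hf : f.Monic) (hirr : Irreducible f) :
    ∃ (c : R) (a b : R[X]), c ≠ 0 ∧ a * f + b * derivative f = C c := by
  let K := FractionRing R
  have hK : CharZero K := IsFractionRing.charZero R
  have hsep : (f.map (algebraMap R K)).Separable :=
    (hf.irreducible_iff_irreducible_map_fraction_map.mp hirr).separable
  obtain ⟨a, b, hab⟩ := hsep
  obtain ⟨s, hsM, hs⟩ := IsLocalization.integerNormalization_spec (nonZeroDivisors R) a
  obtain ⟨t, htM, ht⟩ := IsLocalization.integerNormalization_spec (nonZeroDivisors R) b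
  refine ⟨s * t, C t * IsLocalization.integerNormalization (nonZeroDivisors R) a,
    C s * IsLocalization.integerNormalization (nonZeroDivisors R) b,
    mul_ne_zero (nonZeroDivisors.ne_zero hsM) (nonZeroDivisors.ne_zero htM), ?_⟩
  apply Polynomial.map_injective _ (IsFractionRing.injective R K)
  have hs' : (IsLocalization.integerNormalization (nonZeroDivisors R) a).map (algebraMap R K) =
      C (algebraMap R K s) * a := by
    rw [hs, algebra_compatible_smul K, smul_eq_C_mul]
  have ht' : (IsLocalization.integerNormalization (nonZeroDivisors R) b).map (algebraMap R K) =
      C (algebraMap R K t) * b := by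
    rw [ht, algebra_compatible_smul K, smul_eq_C_mul]
  simp only [Polynomial.map_add, Polynomial.map_mul, map_C, hs', ht', map_mul]
  rw [derivative_map] at hab
  linear_combination C (algebraMap R K s) * C (algebraMap R K t) * hab

variable {σ k : Type*} [Field k]

open Polynomial in
/-- The substitution `Y ↦ Y + t v` on polynomials in `Y` and `t`. -/
noncomputable def shearHom (v : σ → k) : (MvPolynomial σ k)[X] →+* (MvPolynomial σ k)[X] :=
  eval₂RingHom (lineRestrict (R := MvPolynomial σ k) MvPolynomial.X v).toRingHom X

theorem shearHom_comp_neg (v : σ → k) : (shearHom v).comp (shearHom (-v)) = RingHom.id _ := by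
  refine Polynomial.ringHom_ext' (MvPolynomial.ringHom_ext (fun a => ?_) (fun i => ?_)) ?_ <;>
  simp [shearHom, lineRestrict, MvPolynomial.algebraMap_eq]

/-- The shear is an automorphism, and it carries the constant polynomial `F`, which is prime, to
this restriction. -/
theorem prime_lineRestrict_X {F : MvPolynomial σ k} (hF : Prime F) (v : σ → k) :
    Prime (lineRestrict (R := MvPolynomial σ k) MvPolynomial.X v F) := by
  let e : Polynomial (MvPolynomial σ k) ≃+* Polynomial (MvPolynomial σ k) :=
    RingEquiv.ofRingHom (shearHom v) (shearHom (-v)) (shearHom_comp_neg v)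
      (by simpa using shearHom_comp_neg (-v))
  have h : lineRestrict (R := MvPolynomial σ k) MvPolynomial.X v F = e (Polynomial.C F) := by
    change _ = shearHom v (Polynomial.C F)
    simp [shearHom]
  rw [h]
  exact (MulEquiv.prime_iff e).mpr (Polynomial.prime_C_iff.mpr hF)

theorem map_eval_lineRestrict_X (u v : σ → k) (F : MvPolynomial σ k) :
    (lineRestrict (R := MvPolynomial σ k) MvPolynomial.X v F).map (MvPolynomial.eval u) =
      lineRestrict u v F := by
  have : (Polynomial.mapRingHom (MvPolynomial.eval u)).comp
      (lineRestrict (R := MvPolynomial σ k) MvPolynomial.X v).toRingHom =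
      (lineRestrict u v).toRingHom := by
    refine MvPolynomial.ringHom_ext (fun a => ?_) (fun i => ?_) <;>
    simp [lineRestrict, MvPolynomial.algebraMap_eq]
  exact DFunLike.congr_fun this F

/-- Some line meets an irreducible hypersurface in as many points as its degree. -/
theorem exists_separable_lineRestrict [CharZero k] {F : MvPolynomial σ k} (hF : Prime F) :
    ∃ u v : σ → k, v ≠ 0 ∧ (lineRestrict u v F).Separable ∧
      (lineRestrict u v F).natDegree = F.totalDegree := by
  have : Infinite k := inferInstance
  obtain ⟨v, hv⟩ := exists_eval_homogeneousComponent_ne_zero hF.ne_zero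
  set α := MvPolynomial.eval v (MvPolynomial.homogeneousComponent F.totalDegree F) with hα
  set Φ := lineRestrict (R := MvPolynomial σ k) MvPolynomial.X v F with hΦ
  have hunit : IsUnit (Polynomial.C (MvPolynomial.C α⁻¹ : MvPolynomial σ k)) :=
    ((inv_ne_zero hv).isUnit.map MvPolynomial.C).map Polynomial.C
  have hmonic : (Polynomial.C (MvPolynomial.C α⁻¹) * Φ).Monic := by
    refine Polynomial.monic_of_natDegree_le_of_coeff_eq_one F.totalDegree
      ((Polynomial.natDegree_C_mul_le _ _).trans (natDegree_lineRestrict_le _ v F)) ?_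
    rw [Polynomial.coeff_C_mul, coeff_lineRestrict, ← hα, MvPolynomial.algebraMap_eq, ← map_mul,
      inv_mul_cancel₀ hv, map_one]
  have hirr : Irreducible (Polynomial.C (MvPolynomial.C α⁻¹) * Φ) :=
    (irreducible_isUnit_mul hunit).mpr (prime_lineRestrict_X hF v).irreducible
  obtain ⟨c, a, b, hc, hab⟩ := exists_bezout_derivative_of_monic_irreducible hmonic hirr
  -- Here `c` plays the role of a discriminant: where it does not vanish, the Bézout identity
  -- specializes to separability.
  obtain ⟨u, hu⟩ : ∃ u, MvPolynomial.eval u c ≠ 0 := by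
    by_contra! h
    exact hc (MvPolynomial.funext fun u => by rw [h u, map_zero])
  refine ⟨u, v, ?_, ?_, ?_⟩
  · refine ne_zero_of_eval_homogeneousComponent_ne_zero (fun h => ?_) hv
    rw [MvPolynomial.totalDegree_eq_zero_iff_eq_C] at h
    refine hF.not_isUnit (h ▸ IsUnit.map MvPolynomial.C (IsUnit.mk0 _ fun h0 => ?_))
    rw [h0, map_zero] at h
    exact hF.ne_zero h
  · have h := congrArg (Polynomial.map (MvPolynomial.eval u)) hab
    simp only [Polynomial.map_add, Polynomial.map_mul, Polynomial.derivative_C_mul,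
      Polynomial.map_C, MvPolynomial.eval_C, hΦ, ← Polynomial.derivative_map,
      map_eval_lineRestrict_X] at h
    refine ⟨Polynomial.C (MvPolynomial.eval u c)⁻¹ * a.map (MvPolynomial.eval u) * Polynomial.C α⁻¹,
      Polynomial.C (MvPolynomial.eval u c)⁻¹ * b.map (MvPolynomial.eval u) * Polynomial.C α⁻¹, ?_⟩
    have h1 : Polynomial.C (MvPolynomial.eval u c)⁻¹ * Polynomial.C (MvPolynomial.eval u c) = 1 := by
      rw [← map_mul, inv_mul_cancel₀ hu, map_one]
    linear_combination Polynomial.C (MvPolynomial.eval u c)⁻¹ * h + h1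
  · refine le_antisymm (natDegree_lineRestrict_le u v F) (Polynomial.le_natDegree_of_ne_zero ?_)
    rw [coeff_lineRestrict]
    exact hv

end GenericLine

/-! ### Fibres of finite morphisms -/

section FiniteProjection

open MvPolynomial

variable {σ τ k : Type*} [Field k] {p : Ideal (MvPolynomial σ k)}

/-- Lying over for the maximal ideal of `u`; the Nullstellensatz turns the resulting maximal ideal
into a point. -/
theorem exists_mem_zeroLocus_of_isIntegral [IsAlgClosed k] [Finite σ]
    {ψ : MvPolynomial τ k →ₐ[k] MvPolynomial σ k ⧸ p} (hψ : ψ.toRingHom.IsIntegral) (u : τ → k)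
    (hu : ∀ G, ψ G = 0 → eval u G = 0) :
    ∃ x ∈ zeroLocus k p, ∀ G g, ψ G = Ideal.Quotient.mk p g → eval x g = eval u G := by
  let _ : Algebra (MvPolynomial τ k) (MvPolynomial σ k ⧸ p) := ψ.toRingHom.toAlgebra
  have : Algebra.IsIntegral (MvPolynomial τ k) (MvPolynomial σ k ⧸ p) := ⟨hψ⟩
  obtain ⟨Q, hQ, hQP⟩ := Ideal.exists_ideal_over_maximal_of_isIntegral
    (S := MvPolynomial σ k ⧸ p) (vanishingIdeal k {u}) (fun G hG => by
      rw [mem_vanishingIdeal_singleton_iff]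
      exact hu G hG)
  have hQ' : (Q.comap (Ideal.Quotient.mk p)).IsMaximal :=
    Ideal.comap_isMaximal_of_surjective _ Ideal.Quotient.mk_surjective
  obtain ⟨x, hx⟩ := isMaximal_iff_eq_vanishingIdeal_singleton.mp hQ'
  have hmem : ∀ g, Ideal.Quotient.mk p g ∈ Q ↔ eval x g = 0 := fun g => by
    rw [← Ideal.mem_comap, hx, mem_vanishingIdeal_singleton_iff]; rfl
  refine ⟨x, fun g hg => ?_, fun G g h => ?_⟩
  · refine (hmem g).mp ?_
    rw [Ideal.Quotient.eq_zero_iff_mem.mpr hg]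
    exact Q.zero_mem
  · have h1 : G - C (eval u G) ∈ Q.comap (algebraMap (MvPolynomial τ k) (MvPolynomial σ k ⧸ p)) := by
      rw [hQP, mem_vanishingIdeal_singleton_iff]
      simp [aeval_eq_eval]
    have h2 : Ideal.Quotient.mk p (g - C (eval u G)) ∈ Q := by
      have h3 : ψ (G - C (eval u G)) = Ideal.Quotient.mk p (g - C (eval u G)) := by
        rw [map_sub, h, map_sub]
        congr 1
        exact ψ.commutes (eval u G)
      rw [← h3]
      exact h1
    have := (hmem _).mp h2
    rwa [map_sub, eval_C, sub_eq_zero] at this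

/-- Each coordinate satisfies a monic equation over the base, whose specialization at `z` has
finitely many roots. -/
theorem finite_fiber_of_isIntegral [Finite σ] (g : τ → MvPolynomial σ k)
    (hψ : (aeval (R := k) fun i => Ideal.Quotient.mk p (g i)).toRingHom.IsIntegral) (z : τ → k) :
    {x | x ∈ zeroLocus k p ∧ ∀ i, eval x (g i) = z i}.Finite := by
  have key : ∀ j : σ, ∃ f : Polynomial k, f ≠ 0 ∧
      ∀ x ∈ {x | x ∈ zeroLocus k p ∧ ∀ i, eval x (g i) = z i}, f.IsRoot (x j) := by
    intro j
    obtain ⟨f, hf, hfj⟩ := hψ (Ideal.Quotient.mk p (X j))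
    refine ⟨f.map (eval z), (hf.map _).ne_zero, ?_⟩
    rintro x ⟨hx, hxz⟩
    let φ : MvPolynomial σ k ⧸ p →+* k := Ideal.Quotient.lift p (eval x) hx
    have hφmk : ∀ q, φ (Ideal.Quotient.mk p q) = eval x q := fun q => Ideal.Quotient.lift_mk p _ _
    have hφ : φ.comp (aeval (R := k) fun i => Ideal.Quotient.mk p (g i)).toRingHom = eval z := by
      refine ringHom_ext (fun a => ?_) (fun i => ?_)
      · simp only [AlgHom.toRingHom_eq_coe, RingHom.comp_apply, RingHom.coe_coe, algHom_C, eval_C]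
        exact (hφmk (C a)).trans (eval_C a)
      · simp [hφmk, hxz]
    have := congrArg φ hfj
    rw [Polynomial.hom_eval₂, hφ, map_zero, hφmk, eval_X] at this
    rwa [Polynomial.IsRoot, Polynomial.eval_map]
  choose f hf0 hf using key
  refine (Set.Finite.pi' fun j => Polynomial.finite_setOfPred_isRoot (hf0 j)).subset ?_
  exact fun x hx j => hf j x hx

end FiniteProjection

/-! ### Separating a point from an irreducible variety -/

section LinearSection

open MvPolynomial

variable {k : Type*} [Field k] {n : ℕ}

/-- The linear form with coefficients `c`. -/
noncomputable def linearForm (c : Fin n → k) : MvPolynomial (Fin n) k := ∑ j, C (c j) * X j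

theorem eval_linearForm (c x : Fin n → k) : eval x (linearForm c) = ∑ j, c j * x j := by
  simp [linearForm]

theorem totalDegree_linearForm_le (c : Fin n → k) : (linearForm c).totalDegree ≤ 1 :=
  totalDegree_finsetSum_le fun j _ => (totalDegree_mul _ _).trans (by simp)

theorem totalDegree_aeval_le_of_forall_le_one {σ τ R : Type*} [CommRing R] [Nontrivial R]
    {g : τ → MvPolynomial σ R} (hg : ∀ i, (g i).totalDegree ≤ 1) (F : MvPolynomial τ R) :
    (aeval g F).totalDegree ≤ F.totalDegree := by
  conv_lhs => rw [F.as_sum, map_sum]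
  refine totalDegree_finsetSum_le fun m hm => ?_
  rw [aeval_monomial, algebraMap_eq]
  refine (totalDegree_mul _ _).trans ?_
  rw [totalDegree_C, zero_add]
  refine (totalDegree_finsetProd _ _).trans (le_trans ?_ (le_totalDegree hm))
  refine Finset.sum_le_sum fun i _ => (totalDegree_pow _ _).trans ?_
  exact (Nat.mul_le_mul_left _ (hg i)).trans (by simp)

/-- The linear map given by several linear forms. -/
noncomputable def formsMap {m : ℕ} (c : Fin m → Fin n → k) : (Fin n → k) →ₗ[k] (Fin m → k) :=
  Matrix.mulVecLin (Matrix.of c)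

theorem formsMap_apply {m : ℕ} (c : Fin m → Fin n → k) (x : Fin n → k) (i : Fin m) :
    formsMap c x i = eval x (linearForm (c i)) := by
  simp [formsMap, eval_linearForm, Matrix.mulVec, dotProduct]

/-- The restriction of linear forms to an affine variety. -/
noncomputable abbrev formsHom {m : ℕ} (p : Ideal (MvPolynomial (Fin n) k))
    (c : Fin m → Fin n → k) : MvPolynomial (Fin m) k →ₐ[k] MvPolynomial (Fin n) k ⧸ p :=
  aeval fun i => Ideal.Quotient.mk p (linearForm (c i))

theorem formsHom_apply {m : ℕ} (p : Ideal (MvPolynomial (Fin n) k)) (c : Fin m → Fin n → k)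
    (G : MvPolynomial (Fin m) k) :
    formsHom p c G = Ideal.Quotient.mk p (aeval (fun i => linearForm (c i)) G) := by
  have : formsHom p c = (Ideal.Quotient.mkₐ k p).comp (aeval fun i => linearForm (c i)) := by
    ext i; simp
  rw [this]; rfl

theorem eval_aeval_linearForm {m : ℕ} (c : Fin m → Fin n → k) (x : Fin n → k)
    (G : MvPolynomial (Fin m) k) :
    eval x (aeval (fun i => linearForm (c i)) G) = eval (formsMap c x) G := by
  have : (aeval (R := k) x).comp (aeval fun i => linearForm (c i)) = aeval (formsMap c x) := by
    ext i; simp [formsMap_apply, aeval_eq_eval]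
  exact DFunLike.congr_fun this G

theorem exists_formsHom_injective_isIntegral [Infinite k] (p : Ideal (MvPolynomial (Fin n) k))
    [p.IsPrime] : ∃ (r : ℕ) (c : Fin r → Fin n → k), Function.Injective (formsHom p c) ∧
      (formsHom p c).toRingHom.IsIntegral := by
  let x : Fin n → MvPolynomial (Fin n) k ⧸ p := fun j => Ideal.Quotient.mk p (X j)
  have htop : Algebra.adjoin k (Set.range x) = ⊤ := by
    have : Set.range x = (Ideal.Quotient.mkₐ k p) '' Set.range X := by
      rw [← Set.range_comp]; rfl
    rw [this, ← AlgHom.map_adjoin, adjoin_range_X, Algebra.map_top, AlgHom.range_eq_top]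
    exact Ideal.Quotient.mk_surjective
  obtain ⟨r, w, hw, hind, hint⟩ := exists_algebraicIndependent_isIntegral_of_span
    (Submodule.span k (Set.range x)) n x (fun i => Submodule.subset_span ⟨i, rfl⟩) (by
      refine ⟨fun a => ?_⟩
      have ha : a ∈ Algebra.adjoin k (Set.range x) := htop ▸ Algebra.mem_top
      exact isIntegral_algebraMap (x := (⟨a, ha⟩ : Algebra.adjoin k (Set.range x))))
  have hc : ∀ i, ∃ c : Fin n → k, Ideal.Quotient.mk p (linearForm c) = w i := by
    intro i
    obtain ⟨c, hc⟩ := (Submodule.mem_span_range_iff_exists_fun k).mp (hw i)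
    refine ⟨c, ?_⟩
    rw [← hc, linearForm, map_sum]
    refine Finset.sum_congr rfl fun j _ => ?_
    rw [← smul_eq_C_mul]
    rfl
  choose c hc using hc
  have e : formsHom p c = aeval w := by
    simp only [formsHom, hc]
  refine ⟨r, c, e ▸ hind, ?_⟩
  rw [e]
  intro a
  obtain ⟨f, hf, hfa⟩ := hint.isIntegral a
  let ρ : MvPolynomial (Fin r) k →+* Algebra.adjoin k (Set.range w) :=
    (aeval (R := k) w).toRingHom.codRestrict (Algebra.adjoin k (Set.range w)) fun G => by
      rw [Algebra.adjoin_range_eq_range_aeval]; exact ⟨G, rfl⟩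
  have hρ : Function.Surjective ρ := by
    rintro ⟨b, hb⟩
    have hb' := hb
    rw [Algebra.adjoin_range_eq_range_aeval] at hb'
    obtain ⟨G, hG⟩ := hb'
    exact ⟨G, Subtype.ext hG⟩
  obtain ⟨f', hf', -, hm⟩ := Polynomial.lifts_and_degree_eq_and_monic
    (Polynomial.map_surjective ρ hρ f) hf
  refine ⟨f', hm, ?_⟩
  rw [← hf', Polynomial.eval₂_map] at hfa
  exact hfa

/-- The kernel of the restriction of `r + 1` linear forms, the last `r` of which are a Noether
normalization, is generated by a prime element. -/
theorem exists_prime_ker_formsHom_cons {p : Ideal (MvPolynomial (Fin n) k)} [p.IsPrime] {r : ℕ}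
    {c : Fin r → Fin n → k} (hinj : Function.Injective (formsHom p c))
    (hint : (formsHom p c).toRingHom.IsIntegral) (l : Fin n → k) :
    ∃ F : MvPolynomial (Fin (r + 1)) k, Prime F ∧
      ∀ G, formsHom p (Fin.cons l c : Fin (r + 1) → Fin n → k) G = 0 ↔ F ∣ G := by
  let R := MvPolynomial (Fin r) k
  let A := MvPolynomial (Fin n) k ⧸ p
  let _ : Algebra R A := (formsHom p c).toRingHom.toAlgebra
  have : IsScalarTower k R A := IsScalarTower.of_algebraMap_eq' (formsHom p c).comp_algebraMap.symm
  have hI : Algebra.IsIntegral R A := ⟨hint⟩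
  have : FaithfulSMul R A := (faithfulSMul_iff_algebraMap_injective R A).mpr hinj
  let a : A := Ideal.Quotient.mk p (linearForm l)
  have ha : IsIntegral R a := hI.isIntegral a
  have hcomp : formsHom p (Fin.cons l c : Fin (r + 1) → Fin n → k) =
      ((Polynomial.aeval (R := R) a).restrictScalars k).comp (finSuccEquiv k r).toAlgHom := by
    ext i
    refine Fin.cases ?_ (fun i => ?_) i
    · simp [finSuccEquiv_X_zero, a]
    · have h1 : finSuccEquiv k r (X i.succ) = Polynomial.C (X i) := finSuccEquiv_X_succ
      change aeval _ (X i.succ) = Polynomial.aeval a (finSuccEquiv k r (X i.succ))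
      rw [h1, Polynomial.aeval_C, aeval_X, Fin.cons_succ]
      exact (aeval_X (R := k) (fun i => Ideal.Quotient.mk p (linearForm (c i))) i).symm
  -- Since `R` is integrally closed, the minimal polynomial of `a` over `R` is prime and divides
  -- every polynomial that kills `a`.
  refine ⟨(finSuccEquiv k r).symm (minpoly R a), ?_, fun G => ?_⟩
  · exact (MulEquiv.prime_iff (finSuccEquiv k r).symm).mpr (minpoly.prime_of_isIntegrallyClosed ha)
  · rw [hcomp]
    change Polynomial.aeval a (finSuccEquiv k r G) = 0 ↔ _
    rw [minpoly.isIntegrallyClosed_dvd_iff ha]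
    conv_rhs => rw [← (finSuccEquiv k r).symm_apply_apply G]
    exact (map_dvd_iff (finSuccEquiv k r).symm).symm

theorem formsHom_cons_isIntegral {p : Ideal (MvPolynomial (Fin n) k)} {r : ℕ}
    {c : Fin r → Fin n → k} (hint : (formsHom p c).toRingHom.IsIntegral) (l : Fin n → k) :
    (formsHom p (Fin.cons l c : Fin (r + 1) → Fin n → k)).toRingHom.IsIntegral := by
  have h : (formsHom p c).toRingHom =
      (formsHom p (Fin.cons l c : Fin (r + 1) → Fin n → k)).toRingHom.comp
        (rename (R := k) Fin.succ).toRingHom := by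
    have : formsHom p c = (formsHom p (Fin.cons l c : Fin (r + 1) → Fin n → k)).comp
        (rename Fin.succ) := by
      ext i; simp
    rw [this]; rfl
  rw [h] at hint
  exact RingHom.IsIntegral.tower_top _ _ hint

theorem ringKrullDim_quotient_of_formsHom {p : Ideal (MvPolynomial (Fin n) k)} {r : ℕ}
    {c : Fin r → Fin n → k} (hinj : Function.Injective (formsHom p c))
    (hint : (formsHom p c).toRingHom.IsIntegral) :
    ringKrullDim (MvPolynomial (Fin n) k ⧸ p) = r := by
  let _ : Algebra (MvPolynomial (Fin r) k) (MvPolynomial (Fin n) k ⧸ p) :=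
    (formsHom p c).toRingHom.toAlgebra
  have : Algebra.IsIntegral (MvPolynomial (Fin r) k) (MvPolynomial (Fin n) k ⧸ p) := ⟨hint⟩
  rw [ringKrullDim_eq_of_isIntegral_of_injective (R := MvPolynomial (Fin r) k) hinj,
    MvPolynomial.ringKrullDim_of_isNoetherianRing]
  simp [ringKrullDim_eq_zero_of_field]

theorem finrank_comap_span_singleton {V W : Type*} [AddCommGroup V] [Module k V]
    [FiniteDimensional k V] [AddCommGroup W] [Module k W] (f : V →ₗ[k] W)
    (hf : Function.Surjective f) {v : W} (hv : v ≠ 0) :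
    Module.finrank k ((Submodule.span k {v}).comap f) + Module.finrank k W =
      Module.finrank k V + 1 := by
  have : FiniteDimensional k W := Module.Finite.of_surjective f hf
  have h1 := f.finrank_range_add_finrank_ker
  rw [LinearMap.range_eq_top.mpr hf, finrank_top] at h1
  let g := f.restrict (p := (Submodule.span k {v}).comap f) (q := Submodule.span k {v})
    (fun x hx => hx)
  have h2 := g.finrank_range_add_finrank_ker
  have hg : Function.Surjective g := by
    rintro ⟨w, hw⟩
    obtain ⟨x, rfl⟩ := hf w
    exact ⟨⟨x, hw⟩, rfl⟩
  rw [LinearMap.range_eq_top.mpr hg, finrank_top, finrank_span_singleton hv] at h2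
  have h3 : Module.finrank k (LinearMap.ker g) = Module.finrank k (LinearMap.ker f) := by
    have hle : LinearMap.ker f ≤ (Submodule.span k {v}).comap f := fun x hx => by
      rw [Submodule.mem_comap, LinearMap.mem_ker.mp hx]; exact Submodule.zero_mem _
    rw [LinearMap.ker_restrict]
    have := (Submodule.comapSubtypeEquivOfLe hle).finrank_eq
    rw [← this]
  omega

/-- A point outside an affine variety is separated from it by a polynomial whose degree is at most
the number of points in a finite intersection of the variety with a linear subspace of
complementary dimension. -/
theorem exists_mem_eval_ne_zero_totalDegree_le_encard [IsAlgClosed k] [CharZero k]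
    (p : Ideal (MvPolynomial (Fin n) k)) [p.IsPrime] {y : Fin n → k} (hy : y ∉ zeroLocus k p) :
    ∃ F ∈ p, eval y F ≠ 0 ∧ ∃ L : AffineSubspace k (Fin n → k),
      (Module.finrank k L.direction : WithBot ℕ∞) + ringKrullDim (MvPolynomial (Fin n) k ⧸ p) = n ∧
      (zeroLocus k p ∩ (L : Set (Fin n → k))).Finite ∧
      (F.totalDegree : ℕ∞) ≤ (zeroLocus k p ∩ (L : Set (Fin n → k))).encard := by
  classical
  obtain ⟨r, c, hinj, hint⟩ := exists_formsHom_injective_isIntegral p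
  have hfin : ∀ z, {x | x ∈ zeroLocus k p ∧ formsMap c x = z}.Finite := fun z =>
    (finite_fiber_of_isIntegral (fun i => linearForm (c i)) hint z).subset
      fun x hx => ⟨hx.1, fun i => by rw [← formsMap_apply, hx.2]⟩
  have hfib : ∀ z, ∃ x ∈ zeroLocus k p, formsMap c x = z := by
    intro z
    obtain ⟨x, hx, h⟩ := exists_mem_zeroLocus_of_isIntegral hint z (fun G hG => by
      rw [(map_eq_zero_iff _ hinj).mp hG, map_zero])
    refine ⟨x, hx, funext fun i => ?_⟩
    rw [formsMap_apply, h (X i) (linearForm (c i)) (aeval_X _ _), eval_X]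
  -- a linear form separating `y` from the fibre through it
  obtain ⟨l, hl⟩ : ∃ l : Fin n → k, ∀ x ∈ zeroLocus k p, formsMap c x = formsMap c y →
      eval x (linearForm l) ≠ eval y (linearForm l) := by
    have : Finite {x | x ∈ zeroLocus k p ∧ formsMap c x = formsMap c y} := hfin _
    obtain ⟨f, hf⟩ := Module.exists_dual_forall_apply_ne_zero (K := k)
      (fun x : {x | x ∈ zeroLocus k p ∧ formsMap c x = formsMap c y} => x.1 - y)
      (fun x h => hy (sub_eq_zero.mp h ▸ x.2.1))
    have hfe : ∀ x, eval x (linearForm fun j => f (Pi.single j 1)) = f x := by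
      intro x
      rw [eval_linearForm, LinearMap.pi_apply_eq_sum_univ f x]
      refine Finset.sum_congr rfl fun j _ => ?_
      rw [smul_eq_mul, mul_comm]
      congr 2
      ext i
      simp [Pi.single_apply, eq_comm]
    refine ⟨fun j => f (Pi.single j 1), fun x hx hxy h => hf ⟨x, hx, hxy⟩ ?_⟩
    rw [hfe, hfe] at h
    rw [map_sub, h, sub_self]
  obtain ⟨F, hF, hker⟩ := exists_prime_ker_formsHom_cons hinj hint l
  set c' : Fin (r + 1) → Fin n → k := Fin.cons l c with hc'
  have hint' : (formsHom p c').toRingHom.IsIntegral := formsHom_cons_isIntegral hint l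
  have hzero : ∀ x, formsMap c' x 0 = eval x (linearForm l) := fun x => by
    rw [formsMap_apply]; rfl
  have hsucc : ∀ x i, formsMap c' x (Fin.succ i) = formsMap c x i := fun x i => by
    rw [formsMap_apply, formsMap_apply]; rfl
  have hlift : ∀ z, eval z F = 0 → ∃ x ∈ zeroLocus k p, formsMap c' x = z := by
    intro z hz
    obtain ⟨x, hx, h⟩ := exists_mem_zeroLocus_of_isIntegral hint' z (fun G hG => by
      obtain ⟨H, rfl⟩ := (hker G).mp hG
      rw [map_mul, hz, zero_mul])
    refine ⟨x, hx, funext fun i => ?_⟩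
    rw [formsMap_apply, h (X i) (linearForm (c' i)) (aeval_X _ _), eval_X]
  -- The vector `x₁ - y` is killed by the forms `c` but not by `l`, so it adjusts the zeroth
  -- coordinate freely.
  have hsurj : Function.Surjective (formsMap c') := by
    obtain ⟨x₁, hx₁, hxy⟩ := hfib (formsMap c y)
    intro z
    obtain ⟨x₀, -, hx₀⟩ := hfib fun i => z (Fin.succ i)
    have hne := sub_ne_zero.mpr (hl x₁ hx₁ hxy)
    refine ⟨x₀ + ((z 0 - eval x₀ (linearForm l)) /
      (eval x₁ (linearForm l) - eval y (linearForm l))) • (x₁ - y), funext fun i => ?_⟩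
    rw [map_add, map_smul, map_sub]
    refine Fin.cases ?_ (fun i => ?_) i
    · simp only [Pi.add_apply, Pi.smul_apply, Pi.sub_apply, hzero, smul_eq_mul]
      rw [div_mul_cancel₀ _ hne]
      ring
    · simp [hsucc, hx₀, hxy]
  have hmem : aeval (fun i => linearForm (c' i)) F ∈ p := by
    rw [← Ideal.Quotient.eq_zero_iff_mem, ← formsHom_apply]
    exact (hker F).mpr dvd_rfl
  refine ⟨_, hmem, ?_, ?_⟩
  · rw [eval_aeval_linearForm]
    intro h
    obtain ⟨x, hx, hxy⟩ := hlift _ h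
    refine hl x hx (funext fun i => ?_) ?_
    · rw [← hsucc, hxy, hsucc]
    · rw [← hzero, hxy, hzero]
  -- A line meeting the hypersurface `F = 0` in `F.totalDegree` points is pulled back to `L`, of
  -- dimension n + 1 - (r + 1) = n - r. Each intersection point lifts to a point of the variety on
  -- `L`.
  obtain ⟨u, v, hv, hsep, hdeg⟩ := exists_separable_lineRestrict hF
  obtain ⟨x₀, hx₀⟩ := hsurj u
  let f := lineRestrict u v F
  have hf0 : f ≠ 0 := hsep.ne_zero
  have hfe : ∀ t, f.IsRoot t ↔ eval (u + t • v) F = 0 := fun t => by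
    have := eval_lineRestrict (S := k) u v t F
    rw [Polynomial.IsRoot, ← Polynomial.coe_aeval_eq_eval, this, aeval_eq_eval]
    simp only [Algebra.algebraMap_self, RingHom.id_apply]
    have e : (fun i => u i + v i * t) = u + t • v := funext fun i => by simp [mul_comm]
    rw [e]
  let L : AffineSubspace k (Fin n → k) :=
    AffineSubspace.mk' x₀ ((Submodule.span k {v}).comap (formsMap c'))
  have hL : ∀ x, x ∈ L ↔ ∃ t : k, formsMap c' x = u + t • v := by
    intro x
    rw [AffineSubspace.mem_mk', Submodule.mem_comap, Submodule.mem_span_singleton, vsub_eq_sub,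
      map_sub, hx₀]
    exact exists_congr fun t => ⟨fun h => by rw [h]; abel, fun h => by rw [h]; abel⟩
  have hvanish : ∀ x ∈ zeroLocus k p, eval (formsMap c' x) F = 0 := fun x hx => by
    rw [← eval_aeval_linearForm]; exact hx _ hmem
  refine ⟨L, ?_, ?_, ?_⟩
  · have h := finrank_comap_span_singleton _ hsurj hv
    rw [ringKrullDim_quotient_of_formsHom hinj hint, AffineSubspace.direction_mk']
    simp only [Module.finrank_fin_fun] at h
    norm_cast
    omega
  · have hroots : {t | f.IsRoot t}.Finite := Polynomial.finite_setOfPred_isRoot hf0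
    refine (hroots.biUnion fun t _ => hfin fun i => (u + t • v) (Fin.succ i)).subset ?_
    rintro x ⟨hx, hxL⟩
    obtain ⟨t, ht⟩ := (hL x).mp hxL
    refine Set.mem_biUnion (x := t) ?_ ⟨hx, funext fun i => ?_⟩
    · refine (hfe t).mpr ?_
      rw [← ht]
      exact hvanish x hx
    · rw [← hsucc, ht]
  · have hcard : (f.roots.toFinset.card : ℕ∞) = F.totalDegree := by
      rw [Multiset.toFinset_card_of_nodup (Polynomial.nodup_roots hsep),
        IsAlgClosed.card_roots_eq_natDegree, hdeg]
    have hx : ∀ t : f.roots.toFinset, ∃ x ∈ zeroLocus k p, formsMap c' x = u + t.1 • v := by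
      rintro ⟨t, ht⟩
      refine hlift _ ((hfe t).mp ?_)
      exact (Polynomial.mem_roots hf0).mp (Multiset.mem_toFinset.mp ht)
    choose x hxp hx using hx
    have hinjx : Function.Injective x := by
      intro s t h
      have h1 : u + s.1 • v = u + t.1 • v := by rw [← hx, ← hx, h]
      exact Subtype.ext (smul_left_injective k hv (add_left_cancel h1))
    have hsub : Set.range x ⊆ zeroLocus k p ∩ (L : Set (Fin n → k)) := by
      rintro _ ⟨t, rfl⟩
      exact ⟨hxp t, (hL _).mpr ⟨t.1, hx t⟩⟩
    refine le_trans ?_ (Set.encard_le_encard hsub)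
    rw [← Set.image_univ, hinjx.encard_image, Set.encard_univ, ENat.card_eq_coe_fintype_card,
      Fintype.card_coe, hcard]
    exact_mod_cast totalDegree_aeval_le_of_forall_le_one
      (fun i => totalDegree_linearForm_le _) F

end LinearSection

/-! ### Equations of degree at most the geometric degree -/

theorem Gm.exists_mem_eval_ne_zero_totalDegree_le_primeDegree {n : ℕ}
    (p : Ideal (MvPolynomial (Fin n) Qbar)) [p.IsPrime] {y : Fin n → Qbar}
    (hy : y ∉ MvPolynomial.zeroLocus Qbar p) :
    ∃ F ∈ p, MvPolynomial.eval y F ≠ 0 ∧ (F.totalDegree : ℕ∞) ≤ Gm.primeDegree p := by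
  obtain ⟨F, hF, hFy, L, hdim, hfin, hle⟩ := exists_mem_eval_ne_zero_totalDegree_le_encard p hy
  exact ⟨F, hF, hFy, hle.trans (le_iSup₂_of_le L hdim (le_iSup_of_le hfin le_rfl))⟩

/-- A closed subvariety of the torus is cut out by polynomials of degree at most its geometric
degree. -/
theorem Gm.exists_mem_ideal_totalDegree_le_geometricDegree {n : ℕ} {K : Type} [Field K]
    [Algebra K Qbar] {V : Set (Gm n)} (hV : Gm.IsDefinedOver K V) {y : Gm n} (hy : y ∉ V) :
    ∃ F ∈ Gm.ideal V, MvPolynomial.eval (Gm.toAffine y) F ≠ 0 ∧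
      (F.totalDegree : ℕ∞) ≤ Gm.geometricDegree V := by
  obtain ⟨S, hS⟩ := hV
  have hyV : Gm.toAffine y ∉ MvPolynomial.zeroLocus Qbar (Gm.ideal V) := by
    intro h
    apply hy
    rw [hS]
    intro P hP
    have := h (MvPolynomial.map (algebraMap K Qbar) P) (by
      rintro _ ⟨x, hx, rfl⟩
      rw [hS] at hx
      rw [MvPolynomial.aeval_map_algebraMap]
      exact hx P hP)
    rwa [MvPolynomial.aeval_map_algebraMap] at this
  let s := (Ideal.finite_minimalPrimes_of_isNoetherianRing
    (MvPolynomial (Fin n) Qbar) (Gm.ideal V)).toFinset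
  have hs : ∀ p ∈ s, p ∈ (Gm.ideal V).minimalPrimes := fun p hp => by simpa [s] using hp
  have hF : ∀ p : s, ∃ F ∈ p.1, MvPolynomial.eval (Gm.toAffine y) F ≠ 0 ∧
      (F.totalDegree : ℕ∞) ≤ Gm.primeDegree p.1 := by
    rintro ⟨p, hp⟩
    have : p.IsPrime := (hs p hp).1.1
    exact Gm.exists_mem_eval_ne_zero_totalDegree_le_primeDegree p
      fun h => hyV (MvPolynomial.zeroLocus_anti_mono (hs p hp).1.2 h)
  choose F hFp hFy hFd using hF
  -- One separating polynomial per component: the product lies in every minimal prime, hence in the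
  -- radical ideal of `V`, and the degrees add up.
  refine ⟨∏ p, F p, ?_, ?_, ?_⟩
  · have hrad : (Gm.ideal V).radical = Gm.ideal V := by
      refine le_antisymm (fun P ⟨m, hP⟩ x hx => ?_) Ideal.le_radical
      have := hP x hx
      rw [map_pow] at this
      exact eq_zero_of_pow_eq_zero this
    rw [← hrad, ← Ideal.sInf_minimalPrimes, Ideal.mem_sInf]
    intro p hp
    have hp' : p ∈ s := by simpa [s] using hp
    exact Ideal.mem_of_dvd p (Finset.dvd_prod_of_mem F (Finset.mem_univ ⟨p, hp'⟩)) (hFp ⟨p, hp'⟩)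
  · rw [map_prod]
    exact Finset.prod_ne_zero_iff.mpr fun p _ => hFy p
  · calc ((∏ p, F p).totalDegree : ℕ∞) ≤ ((∑ p, (F p).totalDegree : ℕ) : ℕ∞) := by
          exact_mod_cast MvPolynomial.totalDegree_finsetProd _ _
      _ = ∑ p, ((F p).totalDegree : ℕ∞) := by push_cast; rfl
      _ ≤ ∑ p : s, Gm.primeDegree p.1 := Finset.sum_le_sum fun p _ => hFd p
      _ = Gm.geometricDegree V := Finset.sum_coe_sort s Gm.primeDegree

/-! ### Lower bound for the totient -/

section Totient

/-- The i-th smallest element is at least i + 1, so its ratio p/(p - 1) is at most (i + 1)/i, and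
these bounds telescope. -/
theorem Finset.prod_le_card_succ_mul_prod_pred (s : Finset ℕ) (hs : ∀ p ∈ s, 2 ≤ p) :
    ∏ p ∈ s, p ≤ (s.card + 1) * ∏ p ∈ s, (p - 1) := by
  induction s using Finset.induction_on_max with
  | empty => simp
  | insert a s hmax ih =>
    have ha : a ∉ s := fun h => lt_irrefl _ (hmax a h)
    rw [Finset.prod_insert ha, Finset.prod_insert ha, Finset.card_insert_of_notMem ha]
    have hcard : s.card + 2 ≤ a := by
      have hsub : s ⊆ Finset.Ico 2 a := fun p hp =>
        Finset.mem_Ico.mpr ⟨hs p (Finset.mem_insert_of_mem hp), hmax p hp⟩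
      have := Finset.card_le_card hsub
      rw [Nat.card_Ico] at this
      have := hs a (Finset.mem_insert_self a s)
      omega
    obtain ⟨b, rfl⟩ : ∃ b, a = b + 1 := ⟨a - 1, by omega⟩
    have h := ih fun p hp => hs p (Finset.mem_insert_of_mem hp)
    rw [Nat.add_sub_cancel]
    calc (b + 1) * ∏ p ∈ s, p ≤ (b + 1) * ((s.card + 1) * ∏ p ∈ s, (p - 1)) :=
          Nat.mul_le_mul_left _ h
      _ = ((b + 1) * (s.card + 1)) * ∏ p ∈ s, (p - 1) := by ring
      _ ≤ ((s.card + 1 + 1) * b) * ∏ p ∈ s, (p - 1) := by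
          refine Nat.mul_le_mul_right _ ?_
          nlinarith
      _ = _ := by ring

/-- N/φ(N) is the product of p/(p - 1) over the prime factors, and there are at most log₂ N of them.
-/
theorem Nat.le_totient_mul_log_succ (N : ℕ) : N ≤ N.totient * (Nat.log 2 N + 1) := by
  rcases Nat.eq_zero_or_pos N with rfl | hN
  · simp
  have hprime : ∀ p ∈ N.primeFactors, 2 ≤ p := fun p hp => (Nat.prime_of_mem_primeFactors hp).two_le
  have h1 := Finset.prod_le_card_succ_mul_prod_pred _ hprime
  have h2 := Nat.totient_mul_prod_primeFactors N
  have hlog : N.primeFactors.card ≤ Nat.log 2 N := by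
    refine Nat.le_log_of_pow_le (by norm_num) ?_
    calc 2 ^ N.primeFactors.card ≤ ∏ p ∈ N.primeFactors, p := Finset.pow_card_le_prod _ _ _ hprime
      _ ≤ N := Nat.le_of_dvd hN (Nat.prod_primeFactors_dvd N)
  have hpos : 0 < ∏ p ∈ N.primeFactors, (p - 1) := Finset.prod_pos fun p hp => by
    have := hprime p hp; omega
  refine Nat.le_of_mul_le_mul_right ?_ hpos
  calc N * ∏ p ∈ N.primeFactors, (p - 1) = N.totient * ∏ p ∈ N.primeFactors, p := h2.symm
    _ ≤ N.totient * ((N.primeFactors.card + 1) * ∏ p ∈ N.primeFactors, (p - 1)) :=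
        Nat.mul_le_mul_left _ h1
    _ ≤ N.totient * ((Nat.log 2 N + 1) * ∏ p ∈ N.primeFactors, (p - 1)) := by gcongr
    _ = _ := by ring

theorem eventually_mul_log_pow_lt (c n : ℕ) :
    ∃ M : ℕ, ∀ N, M ≤ N → (c * (Nat.log 2 N + 1) + 1) ^ n < N := by
  have h : Filter.Tendsto (fun m : ℕ => ((m : ℝ) ^ n) / (2 : ℝ) ^ m) Filter.atTop (nhds 0) :=
    tendsto_pow_const_div_const_pow_of_one_lt n (by norm_num)
  have hpos : (0 : ℝ) < 1 / ((2 * c + 1 : ℕ) : ℝ) ^ n := by positivity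
  obtain ⟨m₀, hm₀⟩ := Filter.eventually_atTop.mp (h.eventually (gt_mem_nhds hpos))
  -- The `+ 1` forces log₂ N ≥ 1, so the additive constants are absorbed into `(2 * c + 1) * Nat.log
  -- 2 N`.
  refine ⟨2 ^ (m₀ + 1), fun N hN => ?_⟩
  have hN0 : N ≠ 0 := by
    have := Nat.two_pow_pos (m₀ + 1); omega
  have hlog : m₀ + 1 ≤ Nat.log 2 N := Nat.le_log_of_pow_le (by norm_num) hN
  have h1 := hm₀ (Nat.log 2 N) (by omega)
  have hle : c * (Nat.log 2 N + 1) + 1 ≤ (2 * c + 1) * Nat.log 2 N := by nlinarith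
  have h2 : ((2 * c + 1) * Nat.log 2 N) ^ n < 2 ^ Nat.log 2 N := by
    rw [div_lt_div_iff₀ (by positivity) (by positivity), one_mul] at h1
    rw [mul_pow, mul_comm]
    exact_mod_cast h1
  exact ((Nat.pow_le_pow_left hle n).trans_lt h2).trans_le (Nat.pow_log_le_self 2 hN0)

end Totient

/-! ### Diophantine approximation -/

/-- Simultaneous approximation of the fractions `a i / N` with a common denominator. -/
theorem exists_simultaneous_approximation {n : ℕ} (a : Fin n → ℤ) (N X : ℕ) (hN : 0 < N)
    (hX : 0 < X) : ∃ q : ℕ, 0 < q ∧ q ≤ X ^ n ∧ ∃ r : Fin n → ℤ,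
      ∀ i, |(q : ℤ) * a i - N * r i| * X < N := by
  have hN' : (0 : ℤ) < N := by exact_mod_cast hN
  have hX' : (0 : ℤ) < X := by exact_mod_cast hX
  -- Dirichlet's pigeonhole: `X ^ n + 1` multiples of `a`, reduced modulo `N`, fall into `X ^ n`
  -- boxes of side `N / X`; two in the same box are subtracted.
  let m : ℕ → Fin n → ℤ := fun q i => (q * a i) % N
  have hm0 : ∀ q i, 0 ≤ m q i := fun q i => Int.emod_nonneg _ hN'.ne'
  have hmN : ∀ q i, m q i < N := fun q i => Int.emod_lt_of_pos _ hN'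
  let box : ℕ → Fin n → ℕ := fun q i => (m q i * X / N).toNat
  have hbox0 : ∀ q i, 0 ≤ m q i * X / N := fun q i =>
    Int.ediv_nonneg (mul_nonneg (hm0 q i) hX'.le) hN'.le
  have hmaps : ∀ q ∈ Finset.range (X ^ n + 1),
      box q ∈ Fintype.piFinset fun _ : Fin n => Finset.range X := by
    intro q _
    rw [Fintype.mem_piFinset]
    intro i
    rw [Finset.mem_range, Int.toNat_lt (hbox0 q i)]
    refine Int.ediv_lt_of_lt_mul hN' ?_
    have := hmN q i
    nlinarith
  obtain ⟨q₁, hq₁, q₂, hq₂, hne, heq⟩ := Finset.exists_ne_map_eq_of_card_lt_of_maps_to (by simp) hmaps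
  wlog hlt : q₁ < q₂ generalizing q₁ q₂
  · exact this q₂ hq₂ q₁ hq₁ hne.symm heq.symm (by omega)
  rw [Finset.mem_range] at hq₁ hq₂
  refine ⟨q₂ - q₁, by omega, by omega, fun i => q₂ * a i / N - q₁ * a i / N, fun i => ?_⟩
  have e1 := Int.emod_add_mul_ediv (q₁ * a i) N
  have e2 := Int.emod_add_mul_ediv (q₂ * a i) N
  have e3 : ((q₂ - q₁ : ℕ) : ℤ) * a i - N * (q₂ * a i / N - q₁ * a i / N) = m q₂ i - m q₁ i := by
    rw [Nat.cast_sub hlt.le]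
    change _ = (q₂ * a i) % N - (q₁ * a i) % N
    linarith
  rw [e3]
  have hb : m q₁ i * X / N = m q₂ i * X / N := by
    have := congrFun heq i
    have h1 := Int.toNat_of_nonneg (hbox0 q₁ i)
    have h2 := Int.toNat_of_nonneg (hbox0 q₂ i)
    rw [← h1, ← h2]
    exact_mod_cast this
  have f1 := Int.emod_add_mul_ediv (m q₁ i * X) N
  have f2 := Int.emod_add_mul_ediv (m q₂ i * X) N
  have g1 := Int.emod_nonneg (m q₁ i * X) hN'.ne'
  have g2 := Int.emod_nonneg (m q₂ i * X) hN'.ne'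
  have g3 := Int.emod_lt_of_pos (m q₁ i * X) hN'
  have g4 := Int.emod_lt_of_pos (m q₂ i * X) hN'
  rw [hb] at f1
  rw [← abs_of_pos hX', ← abs_mul, abs_lt]
  constructor <;> linarith

/-! ### Galois conjugates of roots of unity -/

theorem Qbar.isAlgebraic : Algebra.IsAlgebraic ℚ Qbar := by
  convert! AlgebraicClosure.isAlgebraic ℚ

theorem IsPrimitiveRoot.totient_le_finrank_mul_natDegree_minpoly (K : IntermediateField ℚ Qbar)
    [NumberField K] {m : ℕ} (hm : 0 < m) {t : Qbar} (ht : IsPrimitiveRoot t m) :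
    m.totient ≤ Module.finrank ℚ K * (minpoly K t).natDegree := by
  have hint : IsIntegral K t := (Qbar.isAlgebraic.isAlgebraic t).isIntegral.tower_top
  have : FiniteDimensional K (IntermediateField.adjoin K {t}) :=
    IntermediateField.adjoin.finiteDimensional hint
  have : FiniteDimensional ℚ (IntermediateField.adjoin K {t}) := FiniteDimensional.trans ℚ K _
  have : Module.Free K (IntermediateField.adjoin K {t}) := Module.Free.of_divisionRing _ _
  have h := minpoly.natDegree_le (A := ℚ) (IntermediateField.AdjoinSimple.gen K t)
  rw [← minpoly.algebraMap_eq (algebraMap (IntermediateField.adjoin K {t}) Qbar).injective,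
    IntermediateField.AdjoinSimple.algebraMap_gen, ← Polynomial.cyclotomic_eq_minpoly_rat ht hm,
    Polynomial.natDegree_cyclotomic, ← Module.finrank_mul_finrank ℚ K (IntermediateField.adjoin K {t}),
    IntermediateField.adjoin.finrank hint] at h
  exact h

/-- A root of unity of order `N * q` has at least `φ N / [K : ℚ]` conjugates over the field
generated over `K` by its `N`-th power. -/
theorem IsPrimitiveRoot.exists_conjugates (K : IntermediateField ℚ Qbar) [NumberField K] {N q : ℕ}
    (hN : 0 < N) (hq : 0 < q) {t : Qbar} (ht : IsPrimitiveRoot t (N * q)) :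
    ∃ s : Finset Qbar, N.totient ≤ Module.finrank ℚ K * s.card ∧
      ∀ x ∈ s, ∃ σ : Qbar ≃ₐ[K] Qbar, σ t = x ∧ σ (t ^ N) = t ^ N := by
  classical
  have hNq : 0 < N * q := Nat.mul_pos hN hq
  have := Qbar.isAlgebraic
  have : Algebra.IsAlgebraic K Qbar := Algebra.IsAlgebraic.tower_top (K := ℚ) K
  have : IsAlgClosure K Qbar := ⟨inferInstance, inferInstance⟩
  have : Normal K Qbar := IsAlgClosure.normal K Qbar
  have hint : IsIntegral K t := Algebra.IsIntegral.isIntegral t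
  let A : Finset Qbar := ((minpoly K t).aroots Qbar).toFinset
  have hA : A.card = (minpoly K t).natDegree := by
    rw [← Polynomial.card_rootSet_eq_natDegree (K := Qbar) (minpoly.irreducible hint).separable
      (IsAlgClosed.splits _)]
    simp_rw [Polynomial.rootSet_def, Finset.coe_sort_coe, Fintype.card_coe]
    rfl
  have hconj : ∀ x ∈ A, ∃ σ : Qbar ≃ₐ[K] Qbar, σ t = x := by
    intro x hx
    have hx' : Polynomial.aeval x (minpoly K t) = 0 := by
      rw [Multiset.mem_toFinset, Polynomial.mem_aroots] at hx
      exact hx.2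
    exact minpoly.exists_algEquiv_of_root' hint.isAlgebraic hx'
  have hpow : IsPrimitiveRoot (t ^ N) q := ht.pow hNq rfl
  have hmaps : ∀ x ∈ A, x ^ N ∈ primitiveRoots q Qbar := by
    intro x hx
    obtain ⟨σ, rfl⟩ := hconj x hx
    rw [mem_primitiveRoots hq, ← map_pow]
    exact hpow.map_of_injective σ.injective
  -- The N-th powers of the conjugates take at most φ(q) values. The most frequent value `y` is hit
  -- by enough conjugates, because φ(N)φ(q) ≤ φ(Nq).
  obtain ⟨y, hy, hmax⟩ := Finset.exists_max_image (primitiveRoots q Qbar)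
    (fun y => (A.filter fun x => x ^ N = y).card) ⟨_, (mem_primitiveRoots hq).mpr hpow⟩
  have hcard := Finset.card_le_mul_card_image_of_maps_to hmaps _ hmax
  rw [hpow.card_primitiveRoots, hA] at hcard
  have hbound : N.totient ≤ Module.finrank ℚ K * (A.filter fun x => x ^ N = y).card := by
    refine Nat.le_of_mul_le_mul_right ?_ (Nat.totient_pos.mpr hq)
    calc N.totient * q.totient ≤ (N * q).totient := Nat.totient_super_multiplicative N q
      _ ≤ Module.finrank ℚ K * (minpoly K t).natDegree :=
          ht.totient_le_finrank_mul_natDegree_minpoly K hNq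
      _ ≤ Module.finrank ℚ K * ((A.filter fun x => x ^ N = y).card * q.totient) :=
          Nat.mul_le_mul_left _ hcard
      _ = _ := by ring
  rcases (A.filter fun x => x ^ N = y).eq_empty_or_nonempty with he | ⟨x₀, hx₀⟩
  · rw [he] at hbound
    exact ⟨∅, hbound, by simp⟩
  obtain ⟨hx₀A, hx₀y⟩ := Finset.mem_filter.mp hx₀
  obtain ⟨σ₀, rfl⟩ := hconj x₀ hx₀A
  -- Applying the inverse of `σ₀`, which sends `t ^ N` to `y`, moves the common N-th power back to
  -- `t ^ N`.
  refine ⟨(A.filter fun x => x ^ N = y).image σ₀.symm, ?_, ?_⟩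
  · rwa [Finset.card_image_of_injective _ σ₀.symm.injective]
  · intro z hz
    obtain ⟨x, hx, rfl⟩ := Finset.mem_image.mp hz
    obtain ⟨hxA, hxy⟩ := Finset.mem_filter.mp hx
    obtain ⟨σ, rfl⟩ := hconj x hxA
    refine ⟨σ.trans σ₀.symm, rfl, ?_⟩
    rw [AlgEquiv.trans_apply, map_pow, hxy, ← hx₀y, ← map_pow, AlgEquiv.symm_apply_apply]

theorem zpow_finsetSum {ι G : Type*} [CommGroup G] (s : Finset ι) (f : ι → ℤ) (a : G) :
    a ^ ∑ i ∈ s, f i = ∏ i ∈ s, a ^ f i := by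
  classical
  induction s using Finset.induction_on with
  | empty => simp
  | insert j s hj ih => rw [Finset.sum_insert hj, Finset.prod_insert hj, zpow_add, ih]

/-! ### Translates of one-parameter subgroups -/

namespace Gm

variable {n : ℕ}

/-- The one-parameter subgroup of the torus with exponents `b`. -/
noncomputable def oneParameter (b : Fin n → ℤ) : Qbarˣ →* Gm n where
  toFun s := fun i => s ^ b i
  map_one' := funext fun _ => one_zpow _
  map_mul' s t := funext fun _ => mul_zpow s t _

theorem oneParameter_apply (b : Fin n → ℤ) (s : Qbarˣ) (i : Fin n) :
    oneParameter b s i = s ^ b i := rfl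

/-- Restriction of a polynomial to a translate of a one-parameter subgroup, with denominators
cleared. -/
theorem exists_polynomial_eval_eq (g : Gm n) {b : Fin n → ℤ} {B D : ℕ} (hb : ∀ i, |b i| ≤ B)
    {P : MvPolynomial (Fin n) Qbar} (hP : P.totalDegree ≤ D) :
    ∃ f : Polynomial Qbar, f.natDegree ≤ 2 * D * B ∧ ∀ s : Qbarˣ,
      f.eval (s : Qbar) = (s : Qbar) ^ (D * B) *
        MvPolynomial.eval (toAffine (g * oneParameter b s)) P := by
  have hm : ∀ m ∈ P.support, |∑ i, (m i : ℤ) * b i| ≤ D * B := by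
    intro m hm
    have hdeg : ∑ i, m i ≤ D := by
      have := (MvPolynomial.le_totalDegree hm).trans hP
      rwa [Finsupp.sum_fintype _ _ fun _ => rfl] at this
    calc |∑ i, (m i : ℤ) * b i| ≤ ∑ i, |(m i : ℤ) * b i| := Finset.abs_sum_le_sum_abs _ _
      _ ≤ ∑ i, (m i : ℤ) * B := Finset.sum_le_sum fun i _ => by
          rw [abs_mul, Nat.abs_cast]
          exact mul_le_mul_of_nonneg_left (hb i) (by positivity)
      _ = ((∑ i, m i : ℕ) : ℤ) * B := by push_cast; rw [Finset.sum_mul]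
      _ ≤ D * B := mul_le_mul_of_nonneg_right (by exact_mod_cast hdeg) (by positivity)
  -- The exponents of s lie between `-(D * B)` and `D * B`; the shift by `D * B` makes them natural
  -- numbers.
  refine ⟨∑ m ∈ P.support, Polynomial.C (P.coeff m * ∏ i, (g i : Qbar) ^ m i) *
    Polynomial.X ^ (D * B + ∑ i, (m i : ℤ) * b i).toNat, ?_, fun s => ?_⟩
  · refine Polynomial.natDegree_sum_le_of_forall_le _ _ fun m hmP => ?_
    refine (Polynomial.natDegree_C_mul_X_pow_le _ _).trans ?_
    have := abs_le.mp (hm m hmP)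
    rw [Int.toNat_le]
    push_cast
    linarith
  · rw [Polynomial.eval_finsetSum, MvPolynomial.eval_eq', Finset.mul_sum]
    refine Finset.sum_congr rfl fun m hmP => ?_
    have hnn : 0 ≤ (D * B : ℤ) + ∑ i, (m i : ℤ) * b i := by
      have := abs_le.mp (hm m hmP)
      linarith
    have hpow : s ^ (D * B + ∑ i, (m i : ℤ) * b i).toNat =
        s ^ (D * B) * ∏ i, (s ^ b i) ^ m i := by
      rw [← zpow_natCast, Int.toNat_of_nonneg hnn, zpow_add]
      refine congrArg₂ _ (by exact_mod_cast zpow_natCast s (D * B)) ?_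
      rw [zpow_finsetSum]
      refine Finset.prod_congr rfl fun i _ => ?_
      rw [mul_comm, zpow_mul, zpow_natCast]
    have hpow' := congrArg (Units.val) hpow
    simp only [Units.val_mul, Units.val_pow_eq_pow_val, Units.coe_prod] at hpow'
    rw [Polynomial.eval_mul, Polynomial.eval_C, Polynomial.eval_pow, Polynomial.eval_X, hpow']
    simp only [toAffine, Pi.mul_apply, Units.val_mul, mul_pow, Finset.prod_mul_distrib,
      oneParameter_apply]
    ring

/-- The translate by `g` of a one-parameter subgroup. -/
def curve (g : Gm n) (b : Fin n → ℤ) : Set (Gm n) := {x | ∃ h ∈ (oneParameter b).range, x = g * h}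

theorem mem_curve (g : Gm n) (b : Fin n → ℤ) (s : Qbarˣ) : g * oneParameter b s ∈ curve g b :=
  ⟨_, ⟨s, rfl⟩, rfl⟩

theorem mem_ideal_iff {V : Set (Gm n)} {P : MvPolynomial (Fin n) Qbar} :
    P ∈ ideal V ↔ ∀ x ∈ V, MvPolynomial.eval (toAffine x) P = 0 := by
  rw [ideal, MvPolynomial.mem_vanishingIdeal_iff]
  simp [MvPolynomial.aeval_eq_eval]

theorem mem_ideal_curve_of_card_lt {g : Gm n} {b : Fin n → ℤ} {B D : ℕ} (hb : ∀ i, |b i| ≤ B)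
    {P : MvPolynomial (Fin n) Qbar} (hP : P.totalDegree ≤ D) {s : Finset Qbar}
    (hs : ∀ x ∈ s, ∃ u : Qbarˣ, (u : Qbar) = x ∧
      MvPolynomial.eval (toAffine (g * oneParameter b u)) P = 0) (hcard : 2 * D * B < s.card) :
    P ∈ ideal (curve g b) := by
  obtain ⟨f, hf, hfe⟩ := exists_polynomial_eval_eq g hb hP
  have hf0 : f = 0 := by
    refine Polynomial.eq_zero_of_natDegree_lt_card_of_eval_eq_zero' f s ?_ (hf.trans_lt hcard)
    intro x hx
    obtain ⟨u, rfl, hu⟩ := hs x hx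
    rw [hfe, hu, mul_zero]
  rw [mem_ideal_iff]
  rintro _ ⟨_, ⟨u, rfl⟩, rfl⟩
  have := hfe u
  rw [hf0, Polynomial.eval_zero] at this
  exact (mul_eq_zero.mp this.symm).resolve_left (pow_ne_zero _ u.ne_zero)

theorem isPrime_ideal_curve (g : Gm n) (b : Fin n → ℤ) : (ideal (curve g b)).IsPrime := by
  refine Ideal.isPrime_iff.mpr ⟨fun h => ?_, fun {P Q} hPQ => ?_⟩
  · have := mem_ideal_iff.mp ((Ideal.eq_top_iff_one _).mp h) _ (mem_curve g b 1)
    simp at this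
  · obtain ⟨B, hB⟩ : ∃ B : ℕ, ∀ i, |b i| ≤ B := by
      refine ⟨∑ i, (b i).natAbs, fun i => ?_⟩
      rw [Int.abs_eq_natAbs]
      exact_mod_cast Finset.single_le_sum (f := fun i => (b i).natAbs) (fun _ _ => Nat.zero_le _)
        (Finset.mem_univ i)
    obtain ⟨f, -, hf⟩ := exists_polynomial_eval_eq g hB (le_refl P.totalDegree)
    obtain ⟨f', -, hf'⟩ := exists_polynomial_eval_eq g hB (le_refl Q.totalDegree)
    -- The factor `X` covers the parameter 0, which is not on the curve.
    have hzero : Polynomial.X * (f * f') = 0 := by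
      refine Polynomial.funext fun x => ?_
      rw [Polynomial.eval_zero, Polynomial.eval_mul, Polynomial.eval_mul, Polynomial.eval_X]
      by_cases hx : x = 0
      · rw [hx, zero_mul]
      · have h := mem_ideal_iff.mp hPQ _ (mem_curve g b (Units.mk0 x hx))
        rw [map_mul] at h
        have h1 := hf (Units.mk0 x hx)
        have h2 := hf' (Units.mk0 x hx)
        rw [Units.val_mk0] at h1 h2
        rw [h1, h2, mul_mul_mul_comm, h, mul_zero, mul_zero]
    have hmem : ∀ {P : MvPolynomial (Fin n) Qbar} {f : Polynomial Qbar} {e : ℕ}, f = 0 →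
        (∀ s : Qbarˣ, f.eval (s : Qbar) = (s : Qbar) ^ e *
          MvPolynomial.eval (toAffine (g * oneParameter b s)) P) → P ∈ ideal (curve g b) := by
      intro P f e h0 h
      rw [mem_ideal_iff]
      rintro _ ⟨_, ⟨u, rfl⟩, rfl⟩
      have := h u
      rw [h0, Polynomial.eval_zero] at this
      exact (mul_eq_zero.mp this.symm).resolve_left (pow_ne_zero _ u.ne_zero)
    rcases mul_eq_zero.mp ((mul_eq_zero.mp hzero).resolve_left Polynomial.X_ne_zero) with h | h
    · exact Or.inl (hmem h hf)
    · exact Or.inr (hmem h hf')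

/-- In dimension zero the prime ideal would be maximal, so the curve a single point; but the
parameters 1 and 2 give different points. -/
theorem dim_curve_pos (g : Gm n) {b : Fin n → ℤ} (hb : b ≠ 0) : 0 < dim (curve g b) := by
  have hprime := isPrime_ideal_curve g b
  obtain ⟨i, hi⟩ := Function.ne_iff.mp hb
  by_contra hdim
  have hle : Ring.KrullDimLE 0 (MvPolynomial (Fin n) Qbar ⧸ ideal (curve g b)) := by
    rw [Ring.krullDimLE_iff]
    exact not_lt.mp hdim
  have hmax := Ideal.Quotient.maximal_of_isField _ (Ring.KrullDimLE.isField_of_isDomain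
    (R := MvPolynomial (Fin n) Qbar ⧸ ideal (curve g b)))
  obtain ⟨z, hz⟩ := MvPolynomial.isMaximal_iff_eq_vanishingIdeal_singleton.mp hmax
  have hmem : MvPolynomial.X i - MvPolynomial.C (z i) ∈ ideal (curve g b) := by
    rw [hz, MvPolynomial.mem_vanishingIdeal_singleton_iff]
    simp
  have hval : ∀ s : Qbarˣ, (g i : Qbar) * ((s ^ b i : Qbarˣ) : Qbar) = z i := fun s => by
    have := mem_ideal_iff.mp hmem _ (mem_curve g b s)
    rw [map_sub, MvPolynomial.eval_X, MvPolynomial.eval_C, sub_eq_zero] at this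
    exact this
  have h12 := (hval 1).trans (hval (Units.mk0 2 two_ne_zero)).symm
  have h2 := mul_left_cancel₀ (g i).ne_zero h12
  rw [one_zpow, Units.val_one, Units.val_zpow_eq_zpow_val, Units.val_mk0] at h2
  have h3 : ((2 : ℚ) ^ b i) = 1 := by
    have : (algebraMap ℚ Qbar) ((2 : ℚ) ^ b i) = algebraMap ℚ Qbar 1 := by
      rw [map_zpow₀, map_one, map_ofNat]; exact h2.symm
    exact (algebraMap ℚ Qbar).injective this
  rw [zpow_eq_one_iff_right₀ (by norm_num) (by norm_num)] at h3
  exact hi h3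

/-- Write b = d b' with d = e · b a greatest common divisor. The relations force x = t^{b'} with t =
∏ x_i^{e_i}, and any d-th root of t is a parameter for x. These monomial equations show that the
subgroup is closed. -/
theorem mem_range_oneParameter_iff {b : Fin n → ℤ} (hb : b ≠ 0) (x : Gm n) :
    x ∈ (oneParameter b).range ↔ ∀ m : Fin n → ℤ, ∑ i, m i * b i = 0 → ∏ i, x i ^ m i = 1 := by
  constructor
  · rintro ⟨s, rfl⟩ m hm
    simp only [oneParameter_apply, ← zpow_mul]
    rw [← zpow_finsetSum]
    simp only [mul_comm (b _), hm, zpow_zero]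
  · intro h
    obtain ⟨d, hd⟩ := (IsPrincipalIdealRing.principal (Ideal.span (Set.range b))).principal
    have hd' : Ideal.span (Set.range b) = Ideal.span {d} := hd
    obtain ⟨e, he⟩ := (Submodule.mem_span_range_iff_exists_fun ℤ).mp
      (show d ∈ Ideal.span (Set.range b) from hd' ▸ Ideal.mem_span_singleton_self d)
    have hdvd : ∀ i, d ∣ b i := fun i => Ideal.mem_span_singleton.mp
      (hd' ▸ Ideal.subset_span ⟨i, rfl⟩)
    choose b' hb' using hdvd
    have hd0 : d ≠ 0 := by
      rintro rfl
      exact hb (funext fun i => by rw [hb' i, zero_mul]; rfl)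
    let t := ∏ i, x i ^ e i
    have hx : ∀ j, x j = t ^ b' j := by
      intro j
      have := h (fun i => (if i = j then 1 else 0) - b' j * e i) (by
        simp only [sub_mul, Finset.sum_sub_distrib, ite_mul, one_mul, zero_mul,
          Finset.sum_ite_eq', Finset.mem_univ, if_true, mul_assoc, ← Finset.mul_sum]
        simp only [smul_eq_mul] at he
        rw [he, hb' j]
        ring)
      simp only [zpow_sub, Finset.prod_mul_distrib, Finset.prod_inv_distrib] at this
      rw [mul_inv_eq_one] at this
      have h1 : ∏ i, x i ^ (if i = j then (1 : ℤ) else 0) = x j := by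
        rw [Finset.prod_eq_single j] <;> simp +contextual
      rw [h1] at this
      rw [this, ← Finset.prod_zpow]
      exact Finset.prod_congr rfl fun i _ => by rw [mul_comm, zpow_mul]
    obtain ⟨s, hs⟩ : ∃ s : Qbarˣ, s ^ d = t := by
      obtain ⟨z, hz⟩ := IsAlgClosed.exists_pow_nat_eq (t : Qbar) (Int.natAbs_pos.mpr hd0)
      have hz0 : z ≠ 0 := by
        rintro rfl
        rw [zero_pow (Int.natAbs_ne_zero.mpr hd0)] at hz
        exact t.ne_zero hz.symm
      have hu : (Units.mk0 z hz0) ^ d.natAbs = t := Units.ext (by simpa using hz)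
      rcases Int.natAbs_eq d with h | h
      · exact ⟨Units.mk0 z hz0, by rw [h, zpow_natCast, hu]⟩
      · exact ⟨(Units.mk0 z hz0)⁻¹, by rw [h, inv_zpow', neg_neg, zpow_natCast, hu]⟩
    refine ⟨s, funext fun j => ?_⟩
    rw [oneParameter_apply, hb' j, zpow_mul, hs, hx j]

theorem isSubtorus_range_oneParameter {b : Fin n → ℤ} (hb : b ≠ 0) :
    IsSubtorus (oneParameter b).range := by
  constructor
  · refine ⟨{P | ∃ m : Fin n → ℤ, ∑ i, m i * b i = 0 ∧
      P = ∏ i, MvPolynomial.X i ^ (m i).toNat - ∏ i, MvPolynomial.X i ^ (-m i).toNat},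
      Set.ext fun x => ?_⟩
    have key : ∀ m : Fin n → ℤ, MvPolynomial.aeval (toAffine x)
        (∏ i, MvPolynomial.X i ^ (m i).toNat - ∏ i, MvPolynomial.X i ^ (-m i).toNat :
          MvPolynomial (Fin n) Qbar) = 0 ↔ ∏ i, x i ^ m i = 1 := by
      intro m
      have h1 : ∏ i, x i ^ m i = (∏ i, x i ^ (m i).toNat) / ∏ i, x i ^ (-m i).toNat := by
        rw [← Finset.prod_div_distrib]
        refine Finset.prod_congr rfl fun i _ => ?_
        conv_lhs => rw [← Int.toNat_sub_toNat_neg (m i), zpow_sub, zpow_natCast, zpow_natCast]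
        rw [div_eq_mul_inv]
      rw [h1, div_eq_one, Units.ext_iff, map_sub, sub_eq_zero]
      simp [toAffine]
    rw [SetLike.mem_coe, mem_range_oneParameter_iff hb]
    constructor
    · rintro h _ ⟨m, hm, rfl⟩
      exact (key m).mpr (h m hm)
    · intro h m hm
      exact (key m).mp (h _ ⟨m, hm, rfl⟩)
  · have : ((oneParameter b).range : Set (Gm n)) = curve 1 b := by
      ext x; simp [curve]
    rw [this]
    exact isPrime_ideal_curve 1 b

theorem isTorsionCoset_curve {g : Gm n} (hg : IsOfFinOrder g) {b : Fin n → ℤ} (hb : b ≠ 0) :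
    IsTorsionCoset (curve g b) :=
  ⟨_, g, isSubtorus_range_oneParameter hb, hg, rfl⟩

end Gm

/-! ### Torsion points on curves with small exponents -/

namespace Gm

variable {n : ℕ}

theorem map_mem_of_isDefinedOver {K : Type} [Field K] [Algebra K Qbar] {V : Set (Gm n)}
    (hV : IsDefinedOver K V) (σ : Qbar ≃ₐ[K] Qbar) {x : Gm n} (hx : x ∈ V) :
    (fun i => Units.map (σ : Qbar →* Qbar) (x i)) ∈ V := by
  obtain ⟨S, rfl⟩ := hV
  intro P hP
  have h : MvPolynomial.aeval (toAffine fun i => Units.map (σ : Qbar →* Qbar) (x i)) P =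
      σ (MvPolynomial.aeval (toAffine x) P) := by
    exact (MvPolynomial.comp_aeval_apply (toAffine x) (σ : Qbar →ₐ[K] Qbar) P).symm
  rw [h, hx P hP, map_zero]

/-- A point of order `N` lies on a translate, by a point of order dividing `q`, of a one-parameter
subgroup with exponents less than `N / X`. -/
theorem exists_eq_mul_oneParameter {ζ : Gm n} {N X : ℕ} (hζ : orderOf ζ = N) (hX : 0 < X)
    (hXN : X ^ n < N) : ∃ (q : ℕ) (t : Qbarˣ) (r b : Fin n → ℤ), 0 < q ∧
      IsPrimitiveRoot (t : Qbar) (N * q) ∧ b ≠ 0 ∧ (∀ i, |b i| * X < N) ∧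
      ζ = (fun i => (t ^ N) ^ r i) * oneParameter b t := by
  have hN : 0 < N := by omega
  -- The denominator `q ≤ X ^ n` is not yet known; a root of unity of order `N * (X ^ n)!` has a
  -- power of order `N * q` for each candidate.
  have hQ : 0 < (X ^ n).factorial := Nat.factorial_pos _
  have hNQ : 0 < N * (X ^ n).factorial := Nat.mul_pos hN hQ
  have : NeZero (N * (X ^ n).factorial) := ⟨hNQ.ne'⟩
  obtain ⟨w, hw⟩ := HasEnoughRootsOfUnity.exists_primitiveRoot Qbar (N * (X ^ n).factorial)
  obtain ⟨W, rfl⟩ := hw.isUnit hNQ.ne'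
  have hω : IsPrimitiveRoot ((W : Qbar) ^ (X ^ n).factorial) N := hw.pow hNQ (mul_comm _ _)
  have ha : ∀ i, ∃ a : ℕ, ζ i = (W ^ (X ^ n).factorial) ^ a := by
    intro i
    have : NeZero N := ⟨hN.ne'⟩
    have h1 : (ζ i : Qbar) ^ N = 1 := by
      have h := congrFun (pow_orderOf_eq_one ζ) i
      rw [hζ] at h
      have h' := congrArg Units.val h
      rwa [Pi.pow_apply, Units.val_pow_eq_pow_val, Pi.one_apply, Units.val_one] at h'
    obtain ⟨a, -, ha⟩ := hω.eq_pow_of_pow_eq_one h1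
    exact ⟨a, Units.ext (by push_cast; exact ha.symm)⟩
  choose a ha using ha
  obtain ⟨q, hq, hqX, r, hr⟩ := exists_simultaneous_approximation (fun i => (a i : ℤ)) N X hN hX
  obtain ⟨e, he⟩ := Nat.dvd_factorial hq hqX
  have ht : IsPrimitiveRoot (((W ^ e : Qbarˣ)) : Qbar) (N * q) := by
    push_cast
    exact hw.pow hNQ (by rw [he]; ring)
  have hpow : (W ^ e) ^ q = W ^ (X ^ n).factorial := by rw [← pow_mul, he, mul_comm e q]
  refine ⟨q, W ^ e, r, fun i => q * a i - N * r i, hq, ht, fun hb => ?_, hr, ?_⟩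
  -- If `b = 0`, then ζ has order at most `q ≤ X ^ n < N`.
  · have hone : ζ ^ q = 1 := by
      funext i
      have hi : (q : ℤ) * a i = N * r i := sub_eq_zero.mp (congrFun hb i)
      have hωN : (W ^ (X ^ n).factorial) ^ N = 1 := Units.ext (by
        push_cast; exact hω.pow_eq_one)
      rw [Pi.pow_apply, ha i, ← pow_mul, ← zpow_natCast, Nat.cast_mul, mul_comm, hi, zpow_mul,
        zpow_natCast, hωN, one_zpow]
      rfl
    have := Nat.le_of_dvd hq (orderOf_dvd_of_pow_eq_one hone)
    omega
  · funext i
    rw [Pi.mul_apply, oneParameter_apply, ha i, ← hpow, ← zpow_natCast (W ^ e) N, ← zpow_mul,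
      ← zpow_add, add_sub_cancel, zpow_mul, zpow_natCast, zpow_natCast]

end Gm

/-! ### Counting conjugates on the curve -/

theorem mainTheorem2 (n d D : ℕ) :
    ∃ M : ℕ, ∀ (K : IntermediateField ℚ Qbar) [NumberField K] (V : Set (Gm n)),
      Module.finrank ℚ K = d → Gm.IsDefinedOver K V → Gm.geometricDegree V = (D : ℕ∞) →
      ∀ ζ ∈ V, IsOfFinOrder ζ → M ≤ orderOf ζ →
        ∃ T : Set (Gm n), Gm.IsTorsionCoset T ∧ 0 < Gm.dim T ∧ ζ ∈ T ∧ T ⊆ V := by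
  obtain ⟨M, hM⟩ := eventually_mul_log_pow_lt (2 * D * d) n
  refine ⟨M, fun K _ V hd hV hD ζ hζV _ hMζ => ?_⟩
  obtain ⟨N, hN⟩ : ∃ N, orderOf ζ = N := ⟨_, rfl⟩
  rw [hN] at hMζ
  obtain ⟨X, hXdef⟩ : ∃ X, X = 2 * D * d * (Nat.log 2 N + 1) + 1 := ⟨_, rfl⟩
  have hXN : X ^ n < N := hXdef ▸ hM N hMζ
  have hX : 0 < X := by omega
  have hN0 : 0 < N := by omega
  obtain ⟨q, t, r, b, hq, ht, hb, hbX, hζ⟩ := Gm.exists_eq_mul_oneParameter hN hX hXN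
  set g : Gm n := fun i => (t ^ N) ^ r i with hg
  have htN : (t ^ N) ^ q = 1 := Units.ext (by
    rw [← pow_mul]; push_cast; exact ht.pow_eq_one)
  have hgfin : IsOfFinOrder g := isOfFinOrder_iff_pow_eq_one.mpr ⟨q, hq, funext fun i => by
    change ((t ^ N) ^ r i) ^ q = 1
    rw [← zpow_natCast, ← zpow_mul, mul_comm, zpow_mul, zpow_natCast, htN, one_zpow]⟩
  refine ⟨Gm.curve g b, Gm.isTorsionCoset_curve hgfin hb, Gm.dim_curve_pos g hb,
    hζ ▸ Gm.mem_curve g b t, fun y hy => ?_⟩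
  by_contra hyV
  obtain ⟨F, hF, hFy, hFD⟩ := Gm.exists_mem_ideal_totalDegree_le_geometricDegree hV hyV
  rw [hD] at hFD
  obtain ⟨s, hs, hconj⟩ := ht.exists_conjugates K hN0 hq
  -- `(N - 1) / X` is the largest integer B with `B * X < N`; this strictness yields the
  -- contradiction in `hcard`.
  have hbB : ∀ i, |b i| ≤ ((N - 1) / X : ℕ) := by
    intro i
    rw [Int.abs_eq_natAbs]
    have h := hbX i
    rw [Int.abs_eq_natAbs] at h
    have h' : (b i).natAbs * X < N := by exact_mod_cast h
    exact_mod_cast (Nat.le_div_iff_mul_le hX).mpr (Nat.le_sub_one_of_lt h')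
  have hcard : 2 * D * ((N - 1) / X) < s.card := by
    by_contra! hle
    have h1 := Nat.le_totient_mul_log_succ N
    have h2 : (N - 1) / X * X ≤ N - 1 := Nat.div_mul_le_self _ _
    have h3 : N ≤ (N - 1) / X * X := by
      calc N ≤ N.totient * (Nat.log 2 N + 1) := h1
        _ ≤ (d * (2 * D * ((N - 1) / X))) * (Nat.log 2 N + 1) := by
            refine Nat.mul_le_mul_right _ (hs.trans ?_)
            rw [hd]
            exact Nat.mul_le_mul_left _ hle
        _ = (N - 1) / X * (2 * D * d * (Nat.log 2 N + 1)) := by ring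
        _ ≤ (N - 1) / X * X := Nat.mul_le_mul_left _ (by omega)
    omega
  refine hFy (Gm.mem_ideal_iff.mp (Gm.mem_ideal_curve_of_card_lt hbB (by exact_mod_cast hFD)
    (fun x hx => ?_) hcard) y hy)
  obtain ⟨σ, hσt, hσN⟩ := hconj x hx
  -- As σ fixes `t ^ N`, it fixes `g`; so the curve point with parameter σ(t) is σ(ζ), which lies on
  -- `V`.
  refine ⟨Units.map (σ : Qbar →* Qbar) t, hσt, ?_⟩
  have hfix : Units.map (σ : Qbar →* Qbar) (t ^ N) = t ^ N := Units.ext (by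
    push_cast; simpa using hσN)
  have hmem := Gm.map_mem_of_isDefinedOver hV σ hζV
  have hσζ : (fun i => Units.map (σ : Qbar →* Qbar) (ζ i)) =
      g * Gm.oneParameter b (Units.map (σ : Qbar →* Qbar) t) := by
    funext i
    rw [hζ, Pi.mul_apply, Pi.mul_apply, map_mul, Gm.oneParameter_apply, Gm.oneParameter_apply,
      map_zpow (Units.map (σ : Qbar →* Qbar)) t, hg, map_zpow, hfix]
  rw [← hσζ]
  exact Gm.mem_ideal_iff.mp hF _ hmem
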